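/- Let $\mathbb H^1$ be the first Heisenberg group, i.e. $\mathbb R^3$ with coordinates $(x,y,z)$, Lebesgue measure $dq$, contact form $\omega=dz-\tfrac12(x\,dy-y\,dx)$ and vector fields $X=\partial_x-\tfrac y2\partial_z$, $Y=\partial_y+\tfrac x2\partial_z$, $Z=\partial_z$; put $r=\sqrt{x^2+y^2}$. A horizontal magnetic field is a smooth closed $2$-form $B=b_1\,dx\wedge\omega+b_2\,dy\wedge\omega$ on $\mathbb H^1$, with real-valued coefficients. A vector potential of $B$ is a smooth real horizontal $1$-form $A=A_X\,dx+A_Y\,dy \bmod \omega$ on $\mathbb H^1$ with $DA=B$, where $D$ is the Rumin differential: with $A_\omega:=XA_Y-YA_X$, $$DA=(XA_\omega-ZA_X)\,dx\wedge\omega+(YA_\omega-ZA_Y)\,dy\wedge\omega .$$ The operator $-\Delta_A$ is the self-adjoint operator in $L^2(\mathbb H^1)$ associated with the closure of the form $Q_A(u)=\int_{\mathbb H^1}\big(|Xu+iA_Xu|^2+|Yu+iA_Yu|^2\big)\,dq$, $u\in C_c^\infty(\mathbb H^1;\mathbb C)$. Let $B$ be a horizontal magnetic field on $\mathbb H^1$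 whose support is contained in the cylinder $\{r\le r_0\}$ for some $r_0>0$, and let $r_1>r_0$. Let $$\mathfrak b(r\cos\varphi,r\sin\varphi,z):=-\int_r^{+\infty}(\cos\varphi\, b_1+\sin\varphi\, b_2)(t\cos\varphi,t\sin\varphi,z)\,dt$$ (the integrand is the coefficient of $dr\wedge\omega$ in $B$), and let $$\mathfrak F_B:=\frac1{2\pi}\int_{\mathbb R^2}\mathfrak b(x,y,0)\,dx\,dy$$ be the flux of $B$. If $\mathfrak F_B\notin\mathbb Z$, then there exists a constant $c(B,r_1)>0$, depending only on $B$ and $r_1$, such that for every vector potential $A$ of $B$ $$-\Delta_A\ \ge\ \frac{c(B,r_1)}{r^2\left(1+\log_-^2\frac r{r_1}\right)}\qquad\text{in } L^2(\mathbb H^1)$$ in the sense of quadratic forms, where $\log_- s:=\max(0,-\log s)$ for $s>0$. -/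

import Mathlib

open MeasureTheory Filter Topology
open scoped ContDiff ENNReal

noncomputable section

namespace Heisenberg

/-- The underlying manifold `ℝ³` of the first Heisenberg group, a point being written
`q = ((x, y), z)`; `volume` is the Lebesgue measure. -/
abbrev H1 : Type := (ℝ × ℝ) × ℝ

section Fields

variable {F : Type*} [NormedAddCommGroup F] [NormedSpace ℝ F]

/-- The left-invariant field `X = ∂_x - (y/2) ∂_z`. -/
def X (f : H1 → F) (q : H1) : F := fderiv ℝ f q ((1, 0), -(q.1.2 / 2))

/-- The left-invariant field `Y = ∂_y + (x/2) ∂_z`. -/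
def Y (f : H1 → F) (q : H1) : F := fderiv ℝ f q ((0, 1), q.1.1 / 2)

/-- The Reeb field `Z = ∂_z = [X, Y]`. -/
def Z (f : H1 → F) (q : H1) : F := fderiv ℝ f q ((0, 0), 1)

end Fields

/-- The distance `r = |ξ| = √(x² + y²)` of `q = (ξ, z)` to the center `{x = y = 0}`. -/
def radius (q : H1) : ℝ := Real.sqrt (q.1.1 ^ 2 + q.1.2 ^ 2)

/-- The azimuth `φ` of `q`, so that `(x, y) = (r cos φ, r sin φ)`. -/
def azimuth (q : H1) : ℝ := Complex.arg ⟨q.1.1, q.1.2⟩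

/-- A horizontal magnetic field on the Heisenberg group: a smooth 2-form
`B = b₁ dx ∧ ω + b₂ dy ∧ ω`, with `ω = dz - (x dy - y dx) / 2`, which is closed.
Since `dω = - dx ∧ dy`, one has `dB = (X b₂ - Y b₁) dx ∧ dy ∧ ω`. -/
structure MagneticField where
  /-- the coefficient of `dx ∧ ω` -/
  b₁ : H1 → ℝ
  /-- the coefficient of `dy ∧ ω` -/
  b₂ : H1 → ℝ
  smooth₁ : ContDiff ℝ ∞ b₁
  smooth₂ : ContDiff ℝ ∞ b₂
  closed : ∀ q, X b₂ q - Y b₁ q = 0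

/-- A smooth vector potential: a horizontal 1-form `A = A_X dx + A_Y dy mod ω`. -/
structure VectorPotential where
  /-- the coefficient of `dx` -/
  AX : H1 → ℝ
  /-- the coefficient of `dy` -/
  AY : H1 → ℝ
  smoothX : ContDiff ℝ ∞ AX
  smoothY : ContDiff ℝ ∞ AY

namespace VectorPotential

/-- The coefficient `A_ω = X A_Y - Y A_X` for which the exterior differential of the lift
`A_X dx + A_Y dy + A_ω ω` has no `dx ∧ dy` component. -/
def lift (A : VectorPotential) (q : H1) : ℝ := X A.AY q - Y A.AX q

/-- `A` is a vector potential of `B`, that is `D A = B` for the Rumin differential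
`D A = d (A_X dx + A_Y dy + A_ω ω)
     = (X A_ω - Z A_X) dx ∧ ω + (Y A_ω - Z A_Y) dy ∧ ω`. -/
def IsPotentialOf (A : VectorPotential) (B : MagneticField) : Prop :=
  (∀ q, X A.lift q - Z A.AX q = B.b₁ q) ∧ (∀ q, Y A.lift q - Z A.AY q = B.b₂ q)

end VectorPotential

namespace MagneticField

/-- The support of `B` (that is, of its coefficients) lies in the cylinder `{r ≤ r₀}`. -/
def SupportedInCylinder (B : MagneticField) (r₀ : ℝ) : Prop :=
  tsupport B.b₁ ⊆ {q | radius q ≤ r₀} ∧ tsupport B.b₂ ⊆ {q | radius q ≤ r₀}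

/-- The coefficient of `dr ∧ ω` when `B` is written in the coframe `dr, r dφ, ω`, at the
point `((t cos φ, t sin φ), z)`. -/
def radialCoeff (B : MagneticField) (t φ z : ℝ) : ℝ :=
  Real.cos φ * B.b₁ ((t * Real.cos φ, t * Real.sin φ), z) +
    Real.sin φ * B.b₂ ((t * Real.cos φ, t * Real.sin φ), z)

/-- The primitive of `B`: minus the integral of the `dr ∧ ω` coefficient along the
horizontal half-line from `q` to infinity, in the direction away from the center. -/
def primitive (B : MagneticField) (q : H1) : ℝ :=
  -∫ t in Set.Ioi (radius q), B.radialCoeff t (azimuth q) q.2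

/-- The flux of `B` through the plane at height `z`. -/
def fluxAt (B : MagneticField) (z : ℝ) : ℝ :=
  1 / (2 * Real.pi) * ∫ ξ : ℝ × ℝ, B.primitive (ξ, z)

/-- The flux of `B`. -/
def flux (B : MagneticField) : ℝ := B.fluxAt 0

end MagneticField

/-- Complex-valued functions in `C_c^∞` of the Heisenberg group. -/
def IsTestFunction (u : H1 → ℂ) : Prop := ContDiff ℝ ∞ u ∧ HasCompactSupport u

/-- The magnetic Dirichlet form `Q_A(u) = ∫ |(d_H + i A) u|² dq` on test functions. -/
def magneticForm (A : VectorPotential) (u : H1 → ℂ) : ℝ :=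
  ∫ q, (‖X u q + Complex.I * (A.AX q : ℂ) * u q‖ ^ 2 +
        ‖Y u q + Complex.I * (A.AY q : ℂ) * u q‖ ^ 2)

/-- `u ∈ L²` belongs to the domain of the closure of the form `Q_A` on `C_c^∞`, and `s` is the
value of the closed form at `u`: there are test functions converging to `u` in `L²` which are
Cauchy for `Q_A`, and whose energies converge to `s`. The closed form is the quadratic form of
the self-adjoint operator `-Δ_A`. -/
def IsClosedFormValue (A : VectorPotential) (u : Lp ℂ 2 (volume : Measure H1)) (s : ℝ) : Prop :=
  ∃ v : ℕ → H1 → ℂ, (∀ n, IsTestFunction (v n)) ∧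
    Tendsto (fun n => eLpNorm (fun q => v n q - u q) 2 volume) atTop (𝓝 0) ∧
    (∀ ε > 0, ∃ N, ∀ m ≥ N, ∀ n ≥ N, magneticForm A (fun q => v m q - v n q) < ε) ∧
    Tendsto (fun n => magneticForm A (v n)) atTop (𝓝 s)

/-- The inequality `-Δ_A ≥ w` in `L²` in the sense of quadratic forms, for a weight `w ≥ 0`:
the form domain of `-Δ_A` is contained in that of `w`, and the closed form of `-Δ_A` dominates
the form of `w` there. -/
def FormLowerBound (A : VectorPotential) (w : H1 → ℝ) : Prop :=
  ∀ (u : Lp ℂ 2 (volume : Measure H1)) (s : ℝ), IsClosedFormValue A u s →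
    Integrable (fun q => w q * ‖u q‖ ^ 2) volume ∧ ∫ q, w q * ‖u q‖ ^ 2 ≤ s

/-- `log_- s = max (0, - log s)`. -/
def logMinus (s : ℝ) : ℝ := max 0 (-Real.log s)

end Heisenberg

end

/-! Outside the cylinder containing the support of `B`, the lift of `A` to a genuine 1-form is
closed. Pulled back by cylindrical coordinates to the convex set `r > r₀` of triples `(r, φ, z)`, it
is `dψ` (`exists_primitive`). By Green's theorem, `ψ` grows by `2π` times the flux over one turn of
`φ` (`primitive_add_two_pi`). So `v = exp(iψ) u` has ordinary derivatives equal in modulus to the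
covariant ones of `u`, and one turn multiplies it by `w = exp(2πi · flux)`, which is not `1`.

Since `ω = dz - (r²/2) dφ`, horizontal circles do not close up: they are helices, and one turn at
radius `r` raises `z` by `πr²`. One turn at radius `b` and two turns at radius `a = b/√2` give the
same rise. Joined by rays, these helices form a closed horizontal loop of net winding one, so `|w -
1| |u|` is bounded by the covariant derivatives along the loop (`holonomy_le`).

With `s = log r`, the integrals of `|u|²/r²` and of the energy density become integrals over `ds dφ
dz` of `|u|²` and of `r²` times that density. This measure is invariant under the translations that
sweep the loops, so integrating the loop estimate over all base points gives a Hardy inequality for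
large `s` (`lintegral_exterior_le`). Near the axis, a one-dimensional logarithmic Hardy inequality
in `s` for `|u|²`, whose boundary term lies in the exterior region, yields the logarithmic weight
(`lintegral_interior_le`). The potential enters no constant. Fatou's lemma extends the bound to the
closed form (`of_testFunction`). -/

noncomputable section

namespace Heisenberg

/-! ### The horizontal frame and the lift of a potential -/

/-- The contact form `dz - (x dy - y dx) / 2` as a covector at `q`. -/
def contactForm (q : H1) : H1 →L[ℝ] ℝ :=
  ContinuousLinearMap.snd ℝ (ℝ × ℝ) ℝ
    - (q.1.1 / 2) • (ContinuousLinearMap.snd ℝ ℝ ℝ).comp (ContinuousLinearMap.fst ℝ (ℝ × ℝ) ℝ)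
    + (q.1.2 / 2) • (ContinuousLinearMap.fst ℝ ℝ ℝ).comp (ContinuousLinearMap.fst ℝ (ℝ × ℝ) ℝ)

lemma contactForm_apply (q h : H1) :
    contactForm q h = h.2 - (q.1.1 / 2) * h.1.2 + (q.1.2 / 2) * h.1.1 := by
  simp [contactForm]

/-- The frame `X, Y, Z` is dual to the coframe `dx, dy, ω`. -/
lemma fderiv_eq_frame {F : Type*} [NormedAddCommGroup F] [NormedSpace ℝ F] (f : H1 → F)
    (q h : H1) :
    fderiv ℝ f q h = h.1.1 • X f q + h.1.2 • Y f q + contactForm q h • Z f q := by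
  have e : h = h.1.1 • (((1, 0), -(q.1.2 / 2)) : H1) + h.1.2 • (((0, 1), q.1.1 / 2) : H1)
      + contactForm q h • (((0, 0), 1) : H1) := by
    rw [contactForm_apply]
    ext <;> simp
    ring
  conv_lhs => rw [e]
  simp only [map_add, map_smul, X, Y, Z]

lemma contDiff_contactForm : ContDiff ℝ ∞ contactForm := by
  unfold contactForm
  fun_prop

lemma contDiff_X {f : H1 → ℝ} (hf : ContDiff ℝ ∞ f) : ContDiff ℝ ∞ (X f) := by
  unfold X
  have := hf.fderiv_right (m := ∞) (by simp)
  fun_prop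

lemma contDiff_Y {f : H1 → ℝ} (hf : ContDiff ℝ ∞ f) : ContDiff ℝ ∞ (Y f) := by
  unfold Y
  have := hf.fderiv_right (m := ∞) (by simp)
  fun_prop

lemma hasFDerivAt_contactForm_apply (q k : H1) :
    HasFDerivAt (fun q => contactForm q k)
      (-(k.1.2 / 2) • (ContinuousLinearMap.fst ℝ ℝ ℝ).comp (ContinuousLinearMap.fst ℝ (ℝ × ℝ) ℝ)
      + (k.1.1 / 2) • (ContinuousLinearMap.snd ℝ ℝ ℝ).comp (ContinuousLinearMap.fst ℝ (ℝ × ℝ) ℝ))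
      q := by
  have : (fun q => contactForm q k) = fun q => (-(k.1.2 / 2) •
      (ContinuousLinearMap.fst ℝ ℝ ℝ).comp (ContinuousLinearMap.fst ℝ (ℝ × ℝ) ℝ)
      + (k.1.1 / 2) • (ContinuousLinearMap.snd ℝ ℝ ℝ).comp
        (ContinuousLinearMap.fst ℝ (ℝ × ℝ) ℝ)) q + k.2 := by
    ext q
    rw [contactForm_apply]
    simp
    ring
  rw [this]
  exact (ContinuousLinearMap.hasFDerivAt _).add_const _

namespace VectorPotential

lemma contDiff_lift (A : VectorPotential) : ContDiff ℝ ∞ A.lift :=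
  (contDiff_X A.smoothY).sub (contDiff_Y A.smoothX)

/-- The lift `A_X dx + A_Y dy + A_ω ω` of a vector potential. -/
def form (A : VectorPotential) (q : H1) : H1 →L[ℝ] ℝ :=
  A.AX q • (ContinuousLinearMap.fst ℝ ℝ ℝ).comp (ContinuousLinearMap.fst ℝ (ℝ × ℝ) ℝ)
    + A.AY q • (ContinuousLinearMap.snd ℝ ℝ ℝ).comp (ContinuousLinearMap.fst ℝ (ℝ × ℝ) ℝ)
    + A.lift q • contactForm q

lemma form_apply (A : VectorPotential) (q h : H1) :
    A.form q h = A.AX q * h.1.1 + A.AY q * h.1.2 + A.lift q * contactForm q h := by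
  simp [form]

lemma contDiff_form (A : VectorPotential) : ContDiff ℝ ∞ A.form := by
  have h1 := A.smoothX
  have h2 := A.smoothY
  have h3 := A.contDiff_lift
  have h4 := contDiff_contactForm
  unfold form
  fun_prop

lemma fderiv_form_apply (A : VectorPotential) (q h k : H1) :
    fderiv ℝ A.form q h k = fderiv ℝ A.AX q h * k.1.1 + fderiv ℝ A.AY q h * k.1.2
      + fderiv ℝ A.lift q h * contactForm q k
      + A.lift q * (-(k.1.2 / 2) * h.1.1 + (k.1.1 / 2) * h.1.2) := by
  have hd : ∀ {f : H1 → ℝ}, ContDiff ℝ ∞ f → HasFDerivAt f (fderiv ℝ f q) q :=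
    fun hf => (hf.differentiable (by simp) q).hasFDerivAt
  have h0 : HasFDerivAt A.form (fderiv ℝ A.form q) q :=
    (A.contDiff_form.differentiable (by simp) q).hasFDerivAt
  have h1 := h0.clm_apply (hasFDerivAt_const k q)
  have h2 := (((hd A.smoothX).mul_const k.1.1).add ((hd A.smoothY).mul_const k.1.2)).add
    ((hd A.contDiff_lift).mul (hasFDerivAt_contactForm_apply q k))
  have h3 := h1.unique (h2.congr_of_eventuallyEq
    (Filter.Eventually.of_forall fun q => by simp [form_apply]))
  have h4 := congrArg (fun L : H1 →L[ℝ] ℝ => L h) h3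
  simp at h4
  rw [h4]
  ring

/-- The exterior derivative of the lift of a vector potential of `B` is `B`. -/
lemma IsPotentialOf.fderiv_form_sub {A : VectorPotential} {B : MagneticField}
    (hA : A.IsPotentialOf B) (q h k : H1) :
    fderiv ℝ A.form q h k - fderiv ℝ A.form q k h =
      B.b₁ q * (h.1.1 * contactForm q k - k.1.1 * contactForm q h)
      + B.b₂ q * (h.1.2 * contactForm q k - k.1.2 * contactForm q h) := by
  rw [fderiv_form_apply, fderiv_form_apply, ← hA.1 q, ← hA.2 q]
  simp only [fderiv_eq_frame _ q h, fderiv_eq_frame _ q k, smul_eq_mul]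
  have : A.lift q = X A.AY q - Y A.AX q := rfl
  linear_combination (k.1.1 * h.1.2 - k.1.2 * h.1.1) * this

end VectorPotential

/-! ### Cylindrical coordinates and a primitive of the potential -/

/-- Cylindrical coordinates `(r, φ, z) ↦ (r cos φ, r sin φ, z)`. -/
def cyl (p : H1) : H1 := ((p.1.1 * Real.cos p.1.2, p.1.1 * Real.sin p.1.2), p.2)

lemma contDiff_cyl : ContDiff ℝ ∞ cyl := by
  unfold cyl
  fun_prop

lemma fderiv_cyl_apply (p h : H1) :
    fderiv ℝ cyl p h = ((h.1.1 * Real.cos p.1.2 - p.1.1 * Real.sin p.1.2 * h.1.2,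
      h.1.1 * Real.sin p.1.2 + p.1.1 * Real.cos p.1.2 * h.1.2), h.2) := by
  have hr : HasFDerivAt (fun p : H1 => p.1.1)
      ((ContinuousLinearMap.fst ℝ ℝ ℝ).comp (ContinuousLinearMap.fst ℝ (ℝ × ℝ) ℝ)) p :=
    ((ContinuousLinearMap.fst ℝ ℝ ℝ).comp (ContinuousLinearMap.fst ℝ (ℝ × ℝ) ℝ)).hasFDerivAt
  have hφ : HasFDerivAt (fun p : H1 => p.1.2)
      ((ContinuousLinearMap.snd ℝ ℝ ℝ).comp (ContinuousLinearMap.fst ℝ (ℝ × ℝ) ℝ)) p :=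
    ((ContinuousLinearMap.snd ℝ ℝ ℝ).comp (ContinuousLinearMap.fst ℝ (ℝ × ℝ) ℝ)).hasFDerivAt
  have h1 : HasFDerivAt cyl _ p := ((hr.mul hφ.cos).prodMk (hr.mul hφ.sin)).prodMk hasFDerivAt_snd
  rw [h1.fderiv]
  ext <;> simp <;> ring

namespace VectorPotential

/-- The lift of a vector potential in cylindrical coordinates. -/
def cylForm (A : VectorPotential) (p : H1) : H1 →L[ℝ] ℝ :=
  (A.form (cyl p)).comp (fderiv ℝ cyl p)

lemma contDiff_cylForm (A : VectorPotential) : ContDiff ℝ ∞ A.cylForm :=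
  (A.contDiff_form.comp contDiff_cyl).clm_comp (contDiff_cyl.fderiv_right (by simp))

lemma cylForm_apply (A : VectorPotential) (p h : H1) :
    A.cylForm p h = A.form (cyl p) (fderiv ℝ cyl p h) := rfl

/-- Exterior differentiation commutes with pullback: the term with the second derivative of `cyl` is
symmetric in `h, k` and cancels. -/
lemma fderiv_cylForm_sub (A : VectorPotential) (p h k : H1) :
    fderiv ℝ A.cylForm p h k - fderiv ℝ A.cylForm p k h =
      fderiv ℝ A.form (cyl p) (fderiv ℝ cyl p h) (fderiv ℝ cyl p k)
        - fderiv ℝ A.form (cyl p) (fderiv ℝ cyl p k) (fderiv ℝ cyl p h) := by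
  have h1 : HasFDerivAt A.form (fderiv ℝ A.form (cyl p)) (cyl p) :=
    (A.contDiff_form.differentiable (by simp) _).hasFDerivAt
  have h2 : HasFDerivAt cyl (fderiv ℝ cyl p) p :=
    (contDiff_cyl.differentiable (by simp) _).hasFDerivAt
  have h3 : HasFDerivAt (fderiv ℝ cyl) (fderiv ℝ (fderiv ℝ cyl) p) p :=
    (((contDiff_cyl.fderiv_right (m := ∞) (by simp)).differentiable (by simp)) _).hasFDerivAt
  have h4 : HasFDerivAt A.cylForm _ p := (h1.comp p h2).clm_comp h3
  have hs : fderiv ℝ (fderiv ℝ cyl) p h k = fderiv ℝ (fderiv ℝ cyl) p k h :=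
    (contDiff_cyl.contDiffAt.isSymmSndFDerivAt (by simpa using WithTop.coe_le_coe.2 (le_top : (2 : ℕ∞) ≤ ⊤))).eq h k
  rw [h4.fderiv]
  simp [hs]

lemma IsPotentialOf.fderiv_cylForm_sub {A : VectorPotential} {B : MagneticField}
    (hA : A.IsPotentialOf B) (p h k : H1) :
    fderiv ℝ A.cylForm p h k - fderiv ℝ A.cylForm p k h =
      B.b₁ (cyl p) * ((fderiv ℝ cyl p h).1.1 * contactForm (cyl p) (fderiv ℝ cyl p k)
          - (fderiv ℝ cyl p k).1.1 * contactForm (cyl p) (fderiv ℝ cyl p h))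
      + B.b₂ (cyl p) * ((fderiv ℝ cyl p h).1.2 * contactForm (cyl p) (fderiv ℝ cyl p k)
          - (fderiv ℝ cyl p k).1.2 * contactForm (cyl p) (fderiv ℝ cyl p h)) := by
  rw [A.fderiv_cylForm_sub, hA.fderiv_form_sub]

end VectorPotential

lemma radius_cyl {p : H1} (hp : 0 ≤ p.1.1) : radius (cyl p) = p.1.1 := by
  have : (p.1.1 * Real.cos p.1.2) ^ 2 + (p.1.1 * Real.sin p.1.2) ^ 2 = p.1.1 ^ 2 := by
    linear_combination p.1.1 ^ 2 * Real.cos_sq_add_sin_sq p.1.2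
  simp only [radius, cyl]
  rw [this, Real.sqrt_sq hp]

lemma MagneticField.SupportedInCylinder.eq_zero {B : MagneticField} {r₀ : ℝ}
    (hB : B.SupportedInCylinder r₀) {q : H1} (hq : r₀ < radius q) :
    B.b₁ q = 0 ∧ B.b₂ q = 0 :=
  ⟨image_eq_zero_of_notMem_tsupport fun h => absurd (hB.1 h) (not_le.2 hq),
    image_eq_zero_of_notMem_tsupport fun h => absurd (hB.2 h) (not_le.2 hq)⟩

/-- Outside the support of the field, the lift of a vector potential is exact in cylindrical
coordinates. -/
lemma VectorPotential.IsPotentialOf.exists_primitive {A : VectorPotential} {B : MagneticField}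
    (hA : A.IsPotentialOf B) {r₀ : ℝ} (hr₀ : 0 < r₀) (hB : B.SupportedInCylinder r₀) :
    ∃ ψ : H1 → ℝ, ∀ p : H1, r₀ < p.1.1 → HasFDerivAt ψ (A.cylForm p) p := by
  have hconv : Convex ℝ {p : H1 | r₀ < p.1.1} :=
    convex_halfSpace_gt (f := fun p : H1 => p.1.1) ⟨fun _ _ => rfl, fun _ _ => rfl⟩ r₀
  have hopen : IsOpen {p : H1 | r₀ < p.1.1} := isOpen_lt continuous_const (by fun_prop)
  refine hconv.exists_forall_hasFDerivAt_of_fderiv_symmetric hopen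
    (A.contDiff_cylForm.differentiable (by simp)).differentiableOn fun p hp h k => ?_
  have hq : r₀ < radius (cyl p) := by
    rwa [radius_cyl (hr₀.trans hp).le]
  rw [← sub_eq_zero, hA.fderiv_cylForm_sub, (hB.eq_zero hq).1, (hB.eq_zero hq).2]
  ring

/-- In these coordinates `ω = dz - (r²/2) dφ`. Hence rays are horizontal, and so are the helices of
constant `r` with `dz = (r²/2) dφ`. -/
lemma contactForm_fderiv_cyl (p h : H1) :
    contactForm (cyl p) (fderiv ℝ cyl p h) = h.2 - p.1.1 ^ 2 / 2 * h.1.2 := by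
  rw [contactForm_apply, fderiv_cyl_apply]
  simp only [cyl]
  linear_combination (-(p.1.1 ^ 2 / 2 * h.1.2)) * Real.cos_sq_add_sin_sq p.1.2

/-! ### Circulation, flux and monodromy -/

/-- The circulation of the lift of a vector potential along a circle, by Green's theorem. -/
lemma VectorPotential.IsPotentialOf.circulation {A : VectorPotential} {B : MagneticField}
    (hA : A.IsPotentialOf B) (R : ℝ) :
    ∫ φ in (-Real.pi)..Real.pi, A.cylForm ((R, φ), 0) ((0, 1), 0) =
      -∫ φ in (-Real.pi)..Real.pi, ∫ r in (0 : ℝ)..R, r ^ 2 / 2 * B.radialCoeff r φ 0 := by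
  let j : ℝ × ℝ →L[ℝ] H1 := ((ContinuousLinearMap.snd ℝ ℝ ℝ).prod
    (ContinuousLinearMap.fst ℝ ℝ ℝ)).prod 0
  have hd : ∀ x : ℝ × ℝ, HasFDerivAt (fun x => A.cylForm (j x))
      ((fderiv ℝ A.cylForm (j x)).comp j) x := fun x =>
    ((A.contDiff_cylForm.differentiable (by simp) (j x)).hasFDerivAt).comp x j.hasFDerivAt
  have hd' : ∀ (x : ℝ × ℝ) (k : H1), HasFDerivAt (fun x => A.cylForm (j x) k) _ x :=
    fun x k => (hd x).clm_apply (hasFDerivAt_const k x)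
  have hc : ∀ k : H1, Continuous fun x => A.cylForm (j x) k := fun k =>
    continuous_iff_continuousAt.2 fun x => (hd' x k).continuousAt
  have key : ∀ x : ℝ × ℝ, fderiv ℝ A.cylForm (j x) ((1, 0), 0) ((0, 1), 0)
      - fderiv ℝ A.cylForm (j x) ((0, 1), 0) ((1, 0), 0) =
      -(x.2 ^ 2 / 2 * B.radialCoeff x.2 x.1 0) := by
    intro x
    rw [hA.fderiv_cylForm_sub]
    simp only [contactForm_fderiv_cyl]
    simp only [fderiv_cyl_apply]
    simp [j, MagneticField.radialCoeff, cyl]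
    ring
  have hrc : Continuous fun x : ℝ × ℝ => -(x.2 ^ 2 / 2 * B.radialCoeff x.2 x.1 0) := by
    have h1 := B.smooth₁.continuous
    have h2 := B.smooth₂.continuous
    unfold MagneticField.radialCoeff
    fun_prop
  -- Green's theorem on the rectangle `[-π, π] × [0, R]` of pairs `(φ, r)`, for a field whose
  -- divergence is `dA(∂_r, ∂_φ)`.
  have G := integral2_divergence_prod_of_hasFDerivAt
    (fun x => -(A.cylForm (j x) ((1, 0), 0))) (fun x => A.cylForm (j x) ((0, 1), 0))
    _ _ (-Real.pi) 0 Real.pi R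
    (hc _).neg.continuousOn (hc _).continuousOn (fun x _ => (hd' x _).neg) (fun x _ => hd' x _)
    (by
      refine (hrc.continuousOn.integrableOn_compact
        (isCompact_uIcc.prod isCompact_uIcc)).congr_fun (fun x _ => ?_)
        (measurableSet_uIcc.prod measurableSet_uIcc)
      change -(x.2 ^ 2 / 2 * B.radialCoeff x.2 x.1 0) = _
      rw [← key]
      simp [j]
      ring)
  -- The edge `r = 0` contributes nothing, since `cyl` collapses it to a point. The edges `φ = ±π`
  -- cancel by periodicity.
  have h0 : ∀ φ : ℝ, A.cylForm ((0, φ), 0) ((0, 1), 0) = 0 := by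
    intro φ
    rw [A.cylForm_apply, fderiv_cyl_apply]
    simp only [zero_mul, sub_zero, add_zero]
    exact (A.form _).map_zero
  have hper : ∀ r : ℝ, A.cylForm ((r, -Real.pi), 0) ((1, 0), 0)
      = A.cylForm ((r, Real.pi), 0) ((1, 0), 0) := by
    intro r
    rw [A.cylForm_apply, A.cylForm_apply, fderiv_cyl_apply, fderiv_cyl_apply]
    simp [cyl]
  have hL : ∀ (x : ℝ × ℝ), j x = ((x.2, x.1), 0) := fun x => rfl
  simp only [hL, hper, h0] at G
  simp only [intervalIntegral.integral_zero, sub_zero, add_sub_cancel_right] at G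
  rw [← G, ← intervalIntegral.integral_neg]
  refine intervalIntegral.integral_congr fun φ _ => ?_
  rw [← intervalIntegral.integral_neg]
  refine intervalIntegral.integral_congr fun r _ => ?_
  have := key (φ, r)
  simp only [hL] at this
  rw [← this]
  simp [j]
  ring

lemma MagneticField.continuous_radialCoeff (B : MagneticField) :
    Continuous fun x : ℝ × ℝ => B.radialCoeff x.1 x.2 0 := by
  have h1 := B.smooth₁.continuous
  have h2 := B.smooth₂.continuous
  unfold MagneticField.radialCoeff
  fun_prop

lemma MagneticField.SupportedInCylinder.radialCoeff_eq_zero {B : MagneticField} {r₀ : ℝ}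
    (hB : B.SupportedInCylinder r₀) (hr₀ : 0 < r₀) {t : ℝ} (ht : r₀ < t) (φ z : ℝ) :
    B.radialCoeff t φ z = 0 := by
  have := hB.eq_zero (q := cyl ((t, φ), z)) (by rwa [radius_cyl (hr₀.trans ht).le])
  simp only [cyl] at this
  rw [MagneticField.radialCoeff, this.1, this.2]
  simp

/-- The half-line is cut at `R`, beyond which the integrand vanishes. If `R < r`, the reversed
interval also lies outside the support and both sides are `0`. -/
lemma MagneticField.SupportedInCylinder.primitive_polar {B : MagneticField} {r₀ R : ℝ}
    (hB : B.SupportedInCylinder r₀) (hr₀ : 0 < r₀) (hR : r₀ ≤ R) {p : ℝ × ℝ}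
    (hp : p ∈ polarCoord.target) :
    B.primitive (polarCoord.symm p, 0) = -∫ t in p.1..R, B.radialCoeff t p.2 0 := by
  have hp' : 0 < p.1 ∧ p.2 ∈ Set.Ioo (-Real.pi) Real.pi := by simpa using hp
  have hr : radius (polarCoord.symm p, 0) = p.1 := radius_cyl (p := (p, 0)) hp'.1.le
  have ha : azimuth (polarCoord.symm p, 0) = p.2 := by
    have : (⟨p.1 * Real.cos p.2, p.1 * Real.sin p.2⟩ : ℂ)
        = p.1 * (Complex.cos p.2 + Complex.sin p.2 * Complex.I) := by
      apply Complex.ext <;> simp [Complex.cos_ofReal_re, Complex.sin_ofReal_re]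
    simp only [azimuth, polarCoord_symm_apply]
    rw [this, Complex.arg_mul_cos_add_sin_mul_I hp'.1 ⟨hp'.2.1, hp'.2.2.le⟩]
  have hz : ∀ {a b : ℝ}, r₀ ≤ a → ∫ t in Set.Ioc a b, B.radialCoeff t p.2 0 = 0 := fun ha =>
    setIntegral_eq_zero_of_forall_eq_zero fun t ht =>
      hB.radialCoeff_eq_zero hr₀ (ha.trans_lt ht.1) _ _
  have hz' : ∀ {a : ℝ}, r₀ ≤ a → ∫ t in Set.Ioi a, B.radialCoeff t p.2 0 = 0 := fun ha =>
    setIntegral_eq_zero_of_forall_eq_zero fun t ht =>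
      hB.radialCoeff_eq_zero hr₀ (lt_of_le_of_lt ha ht) _ _
  rw [MagneticField.primitive, hr, ha]
  congr 1
  rcases le_total p.1 R with h | h
  · rw [intervalIntegral.integral_of_le h]
    refine (setIntegral_eq_of_subset_of_forall_sdiff_eq_zero measurableSet_Ioi
      Set.Ioc_subset_Ioi_self fun t ht => ?_)
    refine hB.radialCoeff_eq_zero hr₀ ?_ _ _
    have h1 : p.1 < t := ht.1
    by_contra h2
    exact ht.2 ⟨h1, by linarith⟩
  · rw [intervalIntegral.integral_of_ge h, hz hR, hz' (hR.trans h), neg_zero]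

/-- Integration by parts; the boundary terms vanish because the tail is `0` at `R` and `r²/2` is `0`
at the origin. -/
lemma integral_id_mul_tail {g : ℝ → ℝ} (hg : Continuous g) (R : ℝ) :
    ∫ r in (0 : ℝ)..R, r * ∫ t in r..R, g t = ∫ r in (0 : ℝ)..R, r ^ 2 / 2 * g r := by
  have h1 : ∀ r : ℝ, HasDerivAt (fun r => ∫ t in r..R, g t) (-g r) r := fun r =>
    intervalIntegral.integral_hasDerivAt_left (hg.intervalIntegrable _ _)
      hg.stronglyMeasurable.stronglyMeasurableAtFilter hg.continuousAt
  have h2 : ∀ r : ℝ, HasDerivAt (fun r : ℝ => r ^ 2 / 2) r r := fun r => by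
    simpa using (hasDerivAt_pow 2 r).div_const 2
  have h3 := intervalIntegral.integral_mul_deriv_eq_deriv_mul (a := 0) (b := R)
    (fun r _ => h1 r) (fun r _ => h2 r) (hg.neg.intervalIntegrable _ _)
    (continuous_id.intervalIntegrable _ _)
  simp only [intervalIntegral.integral_same] at h3
  calc _ = ∫ r in (0 : ℝ)..R, (∫ t in r..R, g t) * r := by simp only [mul_comm]
    _ = _ := by
      rw [h3]
      simp only [neg_mul, intervalIntegral.integral_neg, mul_comm]
      simp

/-- The right side is the one in `circulation`: integrating the flux by parts in polar coordinates
turns the planar integral of `𝔟` into the integral of `B` over a disc at height `0`. -/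
lemma MagneticField.SupportedInCylinder.flux_eq {B : MagneticField} {r₀ R : ℝ}
    (hB : B.SupportedInCylinder r₀) (hr₀ : 0 < r₀) (hR : r₀ ≤ R) :
    2 * Real.pi * B.flux =
      -∫ φ in (-Real.pi)..Real.pi, ∫ r in (0 : ℝ)..R, r ^ 2 / 2 * B.radialCoeff r φ 0 := by
  have hN : Continuous fun p : ℝ × ℝ => ∫ t in p.1..R, B.radialCoeff t p.2 0 := by
    have h1 : Continuous fun p : ℝ × ℝ => ∫ t in (0 : ℝ)..p.1, B.radialCoeff t p.2 0 :=
      intervalIntegral.continuous_parametric_intervalIntegral_of_continuous (μ := volume)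
        (f := fun (p : ℝ × ℝ) t => B.radialCoeff t p.2 0) (a₀ := 0)
        (B.continuous_radialCoeff.comp (by fun_prop : Continuous
          fun x : (ℝ × ℝ) × ℝ => (x.2, x.1.2))) continuous_fst
    have h2 : Continuous fun p : ℝ × ℝ => ∫ t in (0 : ℝ)..R, B.radialCoeff t p.2 0 :=
      intervalIntegral.continuous_parametric_intervalIntegral_of_continuous (μ := volume)
        (f := fun (p : ℝ × ℝ) t => B.radialCoeff t p.2 0) (a₀ := 0)
        (B.continuous_radialCoeff.comp (by fun_prop : Continuous
          fun x : (ℝ × ℝ) × ℝ => (x.2, x.1.2))) continuous_const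
    refine (h2.sub h1).congr fun p => ?_
    have hi : ∀ a b : ℝ, IntervalIntegrable (fun t => B.radialCoeff t p.2 0) volume a b :=
      fun a b => (B.continuous_radialCoeff.comp (by fun_prop : Continuous
          fun t : ℝ => (t, p.2))).intervalIntegrable _ _
    exact intervalIntegral.integral_interval_sub_left (hi _ _) (hi _ _)
  have hRpos : 0 < R := hr₀.trans_le hR
  have e1 : 2 * Real.pi * B.flux = ∫ ξ : ℝ × ℝ, B.primitive (ξ, 0) := by
    rw [MagneticField.flux, MagneticField.fluxAt]
    field_simp
  rw [e1, ← integral_comp_polarCoord_symm]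
  have e2 : ∫ p in polarCoord.target, p.1 • B.primitive (polarCoord.symm p, 0) =
      ∫ p in polarCoord.target, -(p.1 * ∫ t in p.1..R, B.radialCoeff t p.2 0) := by
    refine setIntegral_congr_fun polarCoord.open_target.measurableSet fun p hp => ?_
    rw [hB.primitive_polar hr₀ hR hp, smul_eq_mul, mul_neg]
  have e3 : ∫ p in polarCoord.target, -(p.1 * ∫ t in p.1..R, B.radialCoeff t p.2 0) =
      ∫ p in Set.Ioc 0 R ×ˢ Set.Ioo (-Real.pi) Real.pi,
        -(p.1 * ∫ t in p.1..R, B.radialCoeff t p.2 0) := by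
    refine setIntegral_eq_of_subset_of_forall_sdiff_eq_zero
      polarCoord.open_target.measurableSet ?_ fun p hp => ?_
    · exact Set.prod_mono Set.Ioc_subset_Ioi_self le_rfl
    · have h1 : 0 < p.1 ∧ p.2 ∈ Set.Ioo (-Real.pi) Real.pi := by simpa using hp.1
      have h2 : R < p.1 := by
        by_contra h
        exact hp.2 ⟨⟨h1.1, not_lt.1 h⟩, h1.2⟩
      rw [intervalIntegral.integral_of_ge h2.le, setIntegral_eq_zero_of_forall_eq_zero]
      · simp
      · exact fun t ht => hB.radialCoeff_eq_zero hr₀ (hR.trans_lt ht.1) _ _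
  rw [e2, e3, Measure.volume_eq_prod, ← setIntegral_prod_swap, setIntegral_prod]
  · rw [← integral_Ioc_eq_integral_Ioo, ← intervalIntegral.integral_of_le
      (by linarith [Real.pi_pos]), ← intervalIntegral.integral_neg]
    refine intervalIntegral.integral_congr fun φ _ => ?_
    simp only [Prod.fst_swap, Prod.snd_swap]
    rw [← intervalIntegral.integral_of_le hRpos.le, intervalIntegral.integral_neg]
    congr 1
    exact integral_id_mul_tail (B.continuous_radialCoeff.comp (by fun_prop : Continuous
          fun t : ℝ => (t, φ))) R
  · refine IntegrableOn.mono_set (t := Set.Icc (-Real.pi) Real.pi ×ˢ Set.Icc 0 R) ?_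
      (Set.prod_mono Set.Ioo_subset_Icc_self Set.Ioc_subset_Icc_self)
    refine ContinuousOn.integrableOn_compact (isCompact_Icc.prod isCompact_Icc)
      (Continuous.continuousOn ?_)
    exact (continuous_fst.mul hN).neg.comp continuous_swap

/-- The monodromy of a primitive of the vector potential outside of the support of the field is
given by the flux. -/
lemma VectorPotential.IsPotentialOf.primitive_add_two_pi {A : VectorPotential} {B : MagneticField}
    (hA : A.IsPotentialOf B) {r₀ : ℝ} (hr₀ : 0 < r₀) (hB : B.SupportedInCylinder r₀)
    {ψ : H1 → ℝ} (hψ : ∀ p : H1, r₀ < p.1.1 → HasFDerivAt ψ (A.cylForm p) p)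
    (r φ z : ℝ) (hr : r₀ < r) :
    ψ ((r, φ + 2 * Real.pi), z) = ψ ((r, φ), z) + 2 * Real.pi * B.flux := by
  have hconv : Convex ℝ {p : H1 | r₀ < p.1.1} :=
    convex_halfSpace_gt (f := fun p : H1 => p.1.1) ⟨fun _ _ => rfl, fun _ _ => rfl⟩ r₀
  have hopen : IsOpen {p : H1 | r₀ < p.1.1} := isOpen_lt continuous_const (by fun_prop)
  set e : H1 := ((0, 2 * Real.pi), 0) with he
  have hper : ∀ p : H1, A.cylForm (p + e) = A.cylForm p := by
    intro p
    refine ContinuousLinearMap.ext fun h => ?_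
    rw [A.cylForm_apply, A.cylForm_apply, fderiv_cyl_apply, fderiv_cyl_apply]
    simp [cyl, he]
  have hd : ∀ p : H1, r₀ < p.1.1 → HasFDerivAt (fun p => ψ (p + e) - ψ p) (0 : H1 →L[ℝ] ℝ) p := by
    intro p hp
    have h1 : HasFDerivAt (fun p => ψ (p + e)) (A.cylForm (p + e)) p := by
      have h2 := hψ (p + e) (by simpa [he] using hp)
      exact (hasFDerivAt_comp_add_right e).2 h2
    rw [hper] at h1
    have h3 := h1.sub (hψ p hp)
    rw [sub_self] at h3
    exact h3
  -- The increment over one turn has zero derivative on a convex open set, so it may be computed on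
  -- the circle at height `0` starting from `φ = -π`.
  have hconst : ∀ p q : H1, r₀ < p.1.1 → r₀ < q.1.1 → ψ (p + e) - ψ p = ψ (q + e) - ψ q := by
    intro p q hp hq
    refine hconv.is_const_of_fderivWithin_eq_zero (𝕜 := ℝ) (f := fun p => ψ (p + e) - ψ p)
      (fun x hx => (hd x hx).differentiableAt.differentiableWithinAt) (fun x hx => ?_) hp hq
    rw [fderivWithin_of_isOpen hopen hx, (hd x hx).fderiv]
  have hbase : ψ (((r, -Real.pi), 0) + e) - ψ ((r, -Real.pi), 0) = 2 * Real.pi * B.flux := by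
    rw [hB.flux_eq hr₀ hr.le, ← hA.circulation]
    have hcont : Continuous fun φ : ℝ => A.cylForm ((r, φ), 0) ((0, 1), 0) := by
      have := A.contDiff_cylForm.continuous
      fun_prop
    have hderiv : ∀ φ : ℝ, HasDerivAt (fun φ : ℝ => ψ ((r, φ), 0))
        (A.cylForm ((r, φ), 0) ((0, 1), 0)) φ := fun φ =>
      (hψ ((r, φ), 0) hr).comp_hasDerivAt φ
        (((hasDerivAt_const φ r).prodMk (hasDerivAt_id φ)).prodMk (hasDerivAt_const φ (0 : ℝ)))
    rw [intervalIntegral.integral_eq_sub_of_hasDerivAt (fun φ _ => hderiv φ)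
      (hcont.intervalIntegrable _ _)]
    congr 3
    simp [he]
    ring
  have := hconst ((r, φ), z) ((r, -Real.pi), 0) hr hr
  rw [hbase] at this
  have h2 : (((r, φ), z) : H1) + e = ((r, φ + 2 * Real.pi), z) := by simp [he]
  rw [h2] at this
  linarith

/-! ### Parallel transport and the holonomy inequality -/

lemma sq_integral_le {g : ℝ → ℝ} (hg : Continuous g) {τ : ℝ} (hτ : 0 ≤ τ) :
    (∫ t in (0 : ℝ)..τ, g t) ^ 2 ≤ τ * ∫ t in (0 : ℝ)..τ, g t ^ 2 := by
  rcases hτ.eq_or_lt with rfl | hτ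
  · simp
  -- `m` is the mean of `g`; Cauchy–Schwarz follows from the nonnegativity of the variance.
  set m := (∫ t in (0 : ℝ)..τ, g t) / τ with hm
  have h1 : 0 ≤ ∫ t in (0 : ℝ)..τ, (g t - m) ^ 2 :=
    intervalIntegral.integral_nonneg hτ.le fun t _ => sq_nonneg _
  have hi : ∀ {f : ℝ → ℝ}, Continuous f → IntervalIntegrable f volume 0 τ :=
    fun hf => hf.intervalIntegrable _ _
  have h2 : ∫ t in (0 : ℝ)..τ, (g t - m) ^ 2 =
      (∫ t in (0 : ℝ)..τ, g t ^ 2) - 2 * m * (∫ t in (0 : ℝ)..τ, g t) + τ * m ^ 2 := by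
    have : ∀ t, (g t - m) ^ 2 = g t ^ 2 - 2 * m * g t + m ^ 2 := fun t => by ring
    simp only [this]
    rw [intervalIntegral.integral_add (hi (by fun_prop)) (hi (by fun_prop)),
      intervalIntegral.integral_sub (hi (by fun_prop)) (hi (by fun_prop)),
      intervalIntegral.integral_const_mul, intervalIntegral.integral_const]
    simp
  have h3 : ∫ t in (0 : ℝ)..τ, g t = τ * m := by rw [hm]; field_simp
  rw [h2, h3] at h1
  rw [h3]
  nlinarith

/-- Mean value inequality with the primitive of `√G` as majorant, then Cauchy–Schwarz. A continuous
majorant avoids any regularity assumption on `g'`. -/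
lemma norm_sub_sq_le_integral {g g' : ℝ → ℂ} {G : ℝ → ℝ} (hG : Continuous G) {τ : ℝ}
    (hτ : 0 ≤ τ) (hg : ∀ t ∈ Set.Icc 0 τ, HasDerivAt g (g' t) t)
    (hb : ∀ t ∈ Set.Icc 0 τ, ‖g' t‖ ^ 2 ≤ G t) :
    ‖g τ - g 0‖ ^ 2 ≤ τ * ∫ t in (0 : ℝ)..τ, G t := by
  have hS : Continuous fun t => Real.sqrt (G t) := hG.sqrt
  have hG0 : ∀ t ∈ Set.Icc 0 τ, 0 ≤ G t := fun t ht => (sq_nonneg _).trans (hb t ht)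
  have h1 : ‖g τ - g 0‖ ≤ ∫ t in (0 : ℝ)..τ, Real.sqrt (G t) := by
    refine image_norm_le_of_norm_deriv_right_le_deriv_boundary (f := fun t => g t - g 0)
      (f' := g') (a := 0) (b := τ) (B := fun t => ∫ t in (0 : ℝ)..t, Real.sqrt (G t))
      (B' := fun t => Real.sqrt (G t)) ?_ ?_ ?_ ?_ ?_ (Set.right_mem_Icc.2 hτ)
    · exact fun t ht => ((hg t ht).continuousAt.sub continuousAt_const).continuousWithinAt
    · exact fun t ht => ((hg t (Set.Ico_subset_Icc_self ht)).sub_const _).hasDerivWithinAt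
    · simp
    · exact fun t => intervalIntegral.integral_hasDerivAt_right (hS.intervalIntegrable _ _)
        hS.stronglyMeasurable.stronglyMeasurableAtFilter hS.continuousAt
    · exact fun t ht => Real.le_sqrt_of_sq_le (hb t (Set.Ico_subset_Icc_self ht))
  calc ‖g τ - g 0‖ ^ 2 ≤ (∫ t in (0 : ℝ)..τ, Real.sqrt (G t)) ^ 2 := by gcongr
    _ ≤ τ * ∫ t in (0 : ℝ)..τ, Real.sqrt (G t) ^ 2 := sq_integral_le hS hτ
    _ = τ * ∫ t in (0 : ℝ)..τ, G t := by
      congr 1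
      refine intervalIntegral.integral_congr fun t ht => ?_
      rw [Set.uIcc_of_le hτ] at ht
      exact Real.sq_sqrt (hG0 t ht)

/-- Logarithmic cylindrical coordinates, before composition with `cyl`. -/
def expRadius (p : H1) : H1 := ((Real.exp p.1.1, p.1.2), p.2)

lemma continuous_expRadius : Continuous expRadius := by
  unfold expRadius
  fun_prop

namespace VectorPotential

variable (A : VectorPotential) (u : H1 → ℂ)

/-- The covariant derivative of `u` along `X`. -/
def covX (q : H1) : ℂ := X u q + Complex.I * (A.AX q : ℂ) * u q

/-- The covariant derivative of `u` along `Y`. -/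
def covY (q : H1) : ℂ := Y u q + Complex.I * (A.AY q : ℂ) * u q

/-- The covariant derivative along the unit radial field, in cylindrical coordinates. -/
def covRadial (p : H1) : ℂ :=
  Real.cos p.1.2 * A.covX u (cyl p) + Real.sin p.1.2 * A.covY u (cyl p)

/-- The covariant derivative along the unit angular field, in cylindrical coordinates. -/
def covAngular (p : H1) : ℂ :=
  -Real.sin p.1.2 * A.covX u (cyl p) + Real.cos p.1.2 * A.covY u (cyl p)

/-- The radial and angular fields are obtained from `X` and `Y` by a rotation. -/
lemma norm_covRadial_sq_add (p : H1) :
    ‖A.covRadial u p‖ ^ 2 + ‖A.covAngular u p‖ ^ 2 =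
      ‖A.covX u (cyl p)‖ ^ 2 + ‖A.covY u (cyl p)‖ ^ 2 := by
  simp only [covRadial, covAngular, ← Complex.normSq_eq_norm_sq, Complex.normSq_apply, Complex.add_re,
    Complex.mul_re, Complex.add_im, Complex.mul_im, Complex.neg_re, Complex.neg_im,
    Complex.ofReal_re, Complex.ofReal_im]
  linear_combination ((A.covX u (cyl p)).re ^ 2 + (A.covX u (cyl p)).im ^ 2 +
    (A.covY u (cyl p)).re ^ 2 + (A.covY u (cyl p)).im ^ 2) * Real.sin_sq_add_cos_sq p.1.2

variable {u}

lemma continuous_covX (hu : ContDiff ℝ ∞ u) : Continuous (A.covX u) := by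
  have h1 := (hu.fderiv_right (m := ∞) (by simp)).continuous
  have h2 := A.smoothX.continuous
  have h3 := hu.continuous
  unfold covX X
  fun_prop

lemma continuous_covY (hu : ContDiff ℝ ∞ u) : Continuous (A.covY u) := by
  have h1 := (hu.fderiv_right (m := ∞) (by simp)).continuous
  have h2 := A.smoothY.continuous
  have h3 := hu.continuous
  unfold covY Y
  fun_prop

lemma continuous_covRadial (hu : ContDiff ℝ ∞ u) : Continuous (A.covRadial u) := by
  have h1 := (A.continuous_covX hu).comp contDiff_cyl.continuous
  have h2 := (A.continuous_covY hu).comp contDiff_cyl.continuous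
  simp only [Function.comp_def] at h1 h2
  unfold covRadial
  fun_prop

lemma continuous_covAngular (hu : ContDiff ℝ ∞ u) : Continuous (A.covAngular u) := by
  have h1 := (A.continuous_covX hu).comp contDiff_cyl.continuous
  have h2 := (A.continuous_covY hu).comp contDiff_cyl.continuous
  simp only [Function.comp_def] at h1 h2
  unfold covAngular
  fun_prop

/-- The covariant derivative of `u` along a horizontal vector, in cylindrical coordinates. -/
lemma fderiv_add_cylForm (p k : H1) (hk : k.2 = p.1.1 ^ 2 / 2 * k.1.2) :
    fderiv ℝ u (cyl p) (fderiv ℝ cyl p k) + Complex.I * (A.cylForm p k : ℂ) * u (cyl p) =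
      k.1.1 * A.covRadial u p + (p.1.1 * k.1.2 : ℝ) * A.covAngular u p := by
  have hc : contactForm (cyl p) (fderiv ℝ cyl p k) = 0 := by
    rw [contactForm_fderiv_cyl, hk]; ring
  rw [fderiv_eq_frame, A.cylForm_apply, A.form_apply, hc, fderiv_cyl_apply]
  simp only [covRadial, covAngular, covX, covY, Complex.real_smul]
  push_cast
  ring

/-- The gauge transform of `u` by `ψ`, in cylindrical coordinates. -/
def gauged (ψ : H1 → ℝ) (u : H1 → ℂ) (p : H1) : ℂ := Complex.exp (Complex.I * ψ p) * u (cyl p)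

lemma norm_gauged (ψ : H1 → ℝ) (u : H1 → ℂ) (p : H1) : ‖gauged ψ u p‖ = ‖u (cyl p)‖ := by
  rw [gauged, norm_mul, mul_comm Complex.I, Complex.norm_exp_ofReal_mul_I, one_mul]

/-- Since `dψ` is the lift of `A`, the phase turns the derivative into a covariant one. `hk` says
that the curve is horizontal, so the coefficient `A_ω` plays no role. -/
lemma hasDerivAt_gauged (hu : ContDiff ℝ ∞ u) {ψ : H1 → ℝ} {γ : ℝ → H1} {k : H1} {t : ℝ}
    (hψ : HasFDerivAt ψ (A.cylForm (γ t)) (γ t)) (hγ : HasDerivAt γ k t)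
    (hk : k.2 = (γ t).1.1 ^ 2 / 2 * k.1.2) :
    HasDerivAt (fun t => gauged ψ u (γ t)) (Complex.exp (Complex.I * ψ (γ t)) *
      (k.1.1 * A.covRadial u (γ t) + ((γ t).1.1 * k.1.2 : ℝ) * A.covAngular u (γ t))) t := by
  have h1 : HasDerivAt (fun t => ψ (γ t)) (A.cylForm (γ t) k) t := hψ.comp_hasDerivAt t hγ
  have h2 : HasDerivAt (fun t => cyl (γ t)) (fderiv ℝ cyl (γ t) k) t :=
    (contDiff_cyl.differentiable (by simp) _).hasFDerivAt.comp_hasDerivAt t hγ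
  have h3 : HasDerivAt (fun t => u (cyl (γ t)))
      (fderiv ℝ u (cyl (γ t)) (fderiv ℝ cyl (γ t) k)) t :=
    (hu.differentiable (by simp) _).hasFDerivAt.comp_hasDerivAt t h2
  have h4 := ((h1.ofReal_comp.const_mul Complex.I).cexp).mul h3
  rw [← A.fderiv_add_cylForm _ _ hk]
  convert! h4 using 1
  ring

variable (u)

/-- The radial part of the energy density, in logarithmic cylindrical coordinates. -/
def radialEnergy (p : H1) : ℝ := Real.exp p.1.1 ^ 2 * ‖A.covRadial u (expRadius p)‖ ^ 2

/-- The angular part of the energy density, in logarithmic cylindrical coordinates. -/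
def angularEnergy (p : H1) : ℝ := Real.exp p.1.1 ^ 2 * ‖A.covAngular u (expRadius p)‖ ^ 2

variable {u}

lemma continuous_radialEnergy (hu : ContDiff ℝ ∞ u) : Continuous (A.radialEnergy u) := by
  have := (A.continuous_covRadial hu).comp continuous_expRadius
  simp only [Function.comp_def] at this
  unfold radialEnergy
  fun_prop

lemma continuous_angularEnergy (hu : ContDiff ℝ ∞ u) : Continuous (A.angularEnergy u) := by
  have := (A.continuous_covAngular hu).comp continuous_expRadius
  simp only [Function.comp_def] at this
  unfold angularEnergy
  fun_prop

lemma angularEnergy_add_two_pi (s φ z : ℝ) :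
    A.angularEnergy u ((s, φ + 2 * Real.pi), z) = A.angularEnergy u ((s, φ), z) := by
  simp [angularEnergy, expRadius, covAngular, cyl]

/-- Transport along a helix. -/
lemma norm_gauged_helix_sub_le (hu : ContDiff ℝ ∞ u) {ψ : H1 → ℝ} {r₀ : ℝ}
    (hψ : ∀ p : H1, r₀ < p.1.1 → HasFDerivAt ψ (A.cylForm p) p) {s : ℝ}
    (hs : r₀ < Real.exp s) (φ z : ℝ) {τ : ℝ} (hτ : 0 ≤ τ) :
    ‖gauged ψ u ((Real.exp s, φ + τ), z + Real.exp s ^ 2 / 2 * τ)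
        - gauged ψ u ((Real.exp s, φ), z)‖ ^ 2 ≤
      τ * ∫ t in (0 : ℝ)..τ, A.angularEnergy u ((s, φ + t), z + Real.exp s ^ 2 / 2 * t) := by
  let γ : ℝ → H1 := fun t => ((Real.exp s, φ + t), z + Real.exp s ^ 2 / 2 * t)
  have hγ : ∀ t, HasDerivAt γ ((0, 1), Real.exp s ^ 2 / 2) t := fun t =>
    ((hasDerivAt_const t _).prodMk ((hasDerivAt_id t).const_add φ)).prodMk
      (by simpa using ((hasDerivAt_id t).const_mul (Real.exp s ^ 2 / 2)).const_add z)
  have hc := A.continuous_angularEnergy hu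
  have h := norm_sub_sq_le_integral (g := fun t => gauged ψ u (γ t))
    (G := fun t => A.angularEnergy u ((s, φ + t), z + Real.exp s ^ 2 / 2 * t))
    (by fun_prop) hτ
    (fun t _ => A.hasDerivAt_gauged hu (hψ (γ t) hs) (hγ t) (by simp [γ])) (fun t _ => by
      rw [norm_mul, mul_comm Complex.I, Complex.norm_exp_ofReal_mul_I, one_mul]
      simp [γ, angularEnergy, expRadius, mul_pow])
  simpa [γ] using h

/-- Transport along a ray. -/
lemma norm_gauged_ray_sub_le (hu : ContDiff ℝ ∞ u) {ψ : H1 → ℝ} {r₀ : ℝ}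
    (hψ : ∀ p : H1, r₀ < p.1.1 → HasFDerivAt ψ (A.cylForm p) p) {s τ : ℝ}
    (hs : r₀ < Real.exp (s - τ)) (φ z : ℝ) (hτ : 0 ≤ τ) :
    ‖gauged ψ u ((Real.exp (s - τ), φ), z) - gauged ψ u ((Real.exp s, φ), z)‖ ^ 2 ≤
      τ * ∫ t in (0 : ℝ)..τ, A.radialEnergy u ((s - t, φ), z) := by
  let γ : ℝ → H1 := fun t => ((Real.exp (s - t), φ), z)
  have hγ : ∀ t, HasDerivAt γ ((-Real.exp (s - t), 0), 0) t := fun t =>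
    (HasDerivAt.prodMk (by simpa using ((hasDerivAt_id t).const_sub s).exp)
      (hasDerivAt_const t _)).prodMk (hasDerivAt_const t _)
  have hc := A.continuous_radialEnergy hu
  have h := norm_sub_sq_le_integral (g := fun t => gauged ψ u (γ t))
    (G := fun t => A.radialEnergy u ((s - t, φ), z)) (by fun_prop) hτ
    (fun t ht => A.hasDerivAt_gauged hu
      (hψ (γ t) (hs.trans_le (Real.exp_le_exp.2 (by linarith [ht.2])))) (hγ t) (by simp))
    (fun t _ => by
      rw [norm_mul, mul_comm Complex.I, Complex.norm_exp_ofReal_mul_I, one_mul]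
      simp [γ, radialEnergy, expRadius, mul_pow, -Complex.ofReal_exp])
  simpa [γ] using h

/-- The holonomy inequality: `w² v(a) ≈ v(a)` and `w v(b) ≈ v(b)` along helices with the same
vertical displacement, and `v(a) ≈ v(b)` along rays, for `b² = 2 a²`. -/
lemma IsPotentialOf.holonomy_le {A : VectorPotential} {B : MagneticField}
    (hA : A.IsPotentialOf B) {r₀ : ℝ} (hr₀ : 0 < r₀) (hB : B.SupportedInCylinder r₀)
    (hu : ContDiff ℝ ∞ u) {s : ℝ} (hs : r₀ < Real.exp (s - Real.log 2 / 2)) (φ z : ℝ) :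
    ‖Complex.exp (2 * Real.pi * B.flux * Complex.I) - 1‖ ^ 2 *
        ‖u (cyl (expRadius ((s, φ), z)))‖ ^ 2 ≤
      4 * (2 * Real.pi * (∫ t in (0 : ℝ)..2 * Real.pi,
          A.angularEnergy u ((s, φ + t), z + Real.exp s ^ 2 / 2 * t))
        + 4 * Real.pi * (∫ t in (0 : ℝ)..4 * Real.pi,
          A.angularEnergy u ((s - Real.log 2 / 2, φ + t),
            z + Real.exp (s - Real.log 2 / 2) ^ 2 / 2 * t))
        + Real.log 2 / 2 * (∫ t in (0 : ℝ)..Real.log 2 / 2, A.radialEnergy u ((s - t, φ), z))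
        + Real.log 2 / 2 * (∫ t in (0 : ℝ)..Real.log 2 / 2,
          A.radialEnergy u ((s - t, φ), z + Real.exp s ^ 2 * Real.pi))) := by
  obtain ⟨ψ, hψ⟩ := hA.exists_primitive hr₀ hB
  set L := Real.log 2 / 2 with hL
  have hLpos : 0 ≤ L := by positivity
  set w := Complex.exp (2 * Real.pi * B.flux * Complex.I) with hw
  have hw1 : ‖w‖ = 1 := by
    rw [hw, show (2 * Real.pi * B.flux * Complex.I : ℂ)
      = ((2 * Real.pi * B.flux : ℝ) : ℂ) * Complex.I by push_cast; ring,
      Complex.norm_exp_ofReal_mul_I]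
  have hmon : ∀ r φ z : ℝ, r₀ < r →
      gauged ψ u ((r, φ + 2 * Real.pi), z) = w * gauged ψ u ((r, φ), z) := by
    intro r φ z hr
    rw [gauged, gauged, hA.primitive_add_two_pi hr₀ hB hψ r φ z hr, hw, ← mul_assoc,
      ← Complex.exp_add]
    congr 1
    · congr 1
      push_cast
      ring
    · simp [cyl]
  have hs' : r₀ < Real.exp s := hs.trans_le (Real.exp_le_exp.2 (by linarith))
  -- `L = log √2`: the inner radius is the outer one divided by `√2`, so two inner turns rise as
  -- much as one outer turn.
  have ha : Real.exp (s - L) ^ 2 = Real.exp s ^ 2 / 2 := by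
    rw [← Real.exp_nat_mul, ← Real.exp_nat_mul, show ((2 : ℕ) : ℝ) * (s - L)
      = ((2 : ℕ) : ℝ) * s - Real.log 2 by rw [hL]; push_cast; ring, Real.exp_sub,
      Real.exp_log two_pos]
  have e1 := A.norm_gauged_helix_sub_le hu hψ hs' φ z (τ := 2 * Real.pi) (by positivity)
  have e2 := A.norm_gauged_helix_sub_le hu hψ hs φ z (τ := 4 * Real.pi) (by positivity)
  have e3 := A.norm_gauged_ray_sub_le hu hψ hs φ z hLpos
  have e4 := A.norm_gauged_ray_sub_le hu hψ hs φ (z + Real.exp s ^ 2 * Real.pi) hLpos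
  rw [show Real.exp s ^ 2 / 2 * (2 * Real.pi) = Real.exp s ^ 2 * Real.pi by ring,
    hmon _ _ _ hs'] at e1
  rw [show Real.exp (s - L) ^ 2 / 2 * (4 * Real.pi) = Real.exp s ^ 2 * Real.pi by
    rw [ha]; ring, show φ + 4 * Real.pi = φ + 2 * Real.pi + 2 * Real.pi by ring,
    hmon _ _ _ hs, hmon _ _ _ hs] at e2
  rw [← norm_gauged ψ u]
  simp only [expRadius]
  set b := gauged ψ u ((Real.exp s, φ), z)
  set b' := gauged ψ u ((Real.exp s, φ), z + Real.exp s ^ 2 * Real.pi)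
  set a := gauged ψ u ((Real.exp (s - L), φ), z)
  set a' := gauged ψ u ((Real.exp (s - L), φ), z + Real.exp s ^ 2 * Real.pi)
  -- Telescoping around the loop: each bracket is the defect of transport along one of its four
  -- sides, and the difference in winding leaves `w - 1`.
  have key : (w - 1) * b = -w * (w * b' - b) + (w * (w * a') - a) + (a - b)
      - w ^ 2 * (a' - b') := by ring
  have hn : ‖w - 1‖ * ‖b‖ ≤ ‖w * b' - b‖ + ‖w * (w * a') - a‖ + ‖a - b‖ + ‖a' - b'‖ := by
    rw [← norm_mul, key]
    refine (norm_sub_le _ _).trans ?_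
    refine (add_le_add_left ((norm_add_le _ _).trans (add_le_add_left (norm_add_le _ _) _)) _).trans ?_
    simp [hw1]
  have h4 : ∀ x y z w : ℝ, (x + y + z + w) ^ 2 ≤ 4 * (x ^ 2 + y ^ 2 + z ^ 2 + w ^ 2) := by
    intro x y z w
    nlinarith [sq_nonneg (x - y), sq_nonneg (x - z), sq_nonneg (x - w), sq_nonneg (y - z),
      sq_nonneg (y - w), sq_nonneg (z - w)]
  calc ‖w - 1‖ ^ 2 * ‖b‖ ^ 2 = (‖w - 1‖ * ‖b‖) ^ 2 := by ring
    _ ≤ (‖w * b' - b‖ + ‖w * (w * a') - a‖ + ‖a - b‖ + ‖a' - b'‖) ^ 2 := by gcongr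
    _ ≤ _ := h4 _ _ _ _
    _ ≤ _ := by gcongr

end VectorPotential

/-! ### Averaging over translations in logarithmic coordinates -/

/-- The measure `ds dφ dz` over one turn in logarithmic cylindrical coordinates. -/
def logMeasure : Measure H1 :=
  ((volume : Measure ℝ).prod (volume.restrict (Set.Ioc (-Real.pi) Real.pi))).prod volume

instance : SFinite logMeasure := by
  unfold logMeasure
  infer_instance

lemma lintegral_logMeasure {F : H1 → ℝ≥0∞} (hF : Measurable F) :
    ∫⁻ p, F p ∂logMeasure =
      ∫⁻ s, ∫⁻ φ in Set.Ioc (-Real.pi) Real.pi, ∫⁻ z, F ((s, φ), z) := by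
  rw [logMeasure, lintegral_prod _ hF.aemeasurable,
    lintegral_prod _ (hF.lintegral_prod_right' (ν := volume)).aemeasurable]

lemma lintegral_logMeasure_symm {F : H1 → ℝ≥0∞} (hF : Measurable F) :
    ∫⁻ p, F p ∂logMeasure =
      ∫⁻ z, ∫⁻ φ in Set.Ioc (-Real.pi) Real.pi, ∫⁻ s, F ((s, φ), z) := by
  rw [logMeasure, lintegral_prod_symm _ hF.aemeasurable]
  refine lintegral_congr fun z => ?_
  have h : Measurable fun x : ℝ × ℝ => F (x, z) := hF.comp (by fun_prop)
  rw [lintegral_prod_symm _ h.aemeasurable]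

lemma setLIntegral_Ioc_add_of_periodic {f : ℝ → ℝ≥0∞} {T : ℝ} (hT : 0 < T)
    (hf : Function.Periodic f T) (a τ : ℝ) :
    ∫⁻ φ in Set.Ioc a (a + T), f (φ + τ) = ∫⁻ φ in Set.Ioc a (a + T), f φ := by
  have h1 := (measurePreserving_add_right volume τ).setLIntegral_comp_emb
    (measurableEmbedding_addRight τ) f (Set.Ioc a (a + T))
  rw [h1, Set.image_add_const_Ioc, add_right_comm]
  have : VAddInvariantMeasure (AddSubgroup.zmultiples T) ℝ volume :=
    ⟨fun c s _ => measure_preimage_add _ _ _⟩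
  -- Any two windows of length `T` are fundamental domains for the period lattice.
  exact (isAddFundamentalDomain_Ioc hT (a + τ)).setLIntegral_eq
    (isAddFundamentalDomain_Ioc hT a) f hf.map_vadd_zmultiples

/-- The shift in `z` may depend on `s` because `z` is integrated first, with `s` fixed; then the
rotation is removed by periodicity and finally the shift in `s`. -/
lemma lintegral_logMeasure_translate {F : H1 → ℝ≥0∞} (hF : Measurable F)
    (hper : ∀ s φ z, F ((s, φ + 2 * Real.pi), z) = F ((s, φ), z))
    {c : ℝ → ℝ} (hc : Measurable c) (l τ : ℝ) :
    ∫⁻ p, F ((p.1.1 - l, p.1.2 + τ), p.2 + c p.1.1) ∂logMeasure = ∫⁻ p, F p ∂logMeasure := by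
  have hz : ∀ s φ c, ∫⁻ z, F ((s, φ), z + c) = ∫⁻ z, F ((s, φ), z) := fun s φ c =>
    lintegral_add_right_eq_self (fun z => F ((s, φ), z)) c
  have h0 : Measurable fun p : H1 => F ((p.1.1 - l, p.1.2 + τ), p.2 + c p.1.1) :=
    hF.comp (by fun_prop)
  rw [lintegral_logMeasure hF, lintegral_logMeasure h0]
  have h1 : ∀ s, ∫⁻ φ in Set.Ioc (-Real.pi) Real.pi, ∫⁻ z, F ((s - l, φ + τ), z + c s) =
      ∫⁻ φ in Set.Ioc (-Real.pi) Real.pi, ∫⁻ z, F ((s - l, φ), z) := by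
    intro s
    simp only [hz]
    have h2 := setLIntegral_Ioc_add_of_periodic (f := fun φ => ∫⁻ z, F ((s - l, φ), z))
      (T := 2 * Real.pi) (by positivity) (fun φ => by simp only [hper]) (-Real.pi) τ
    rwa [show -Real.pi + 2 * Real.pi = Real.pi by ring] at h2
  simp only [h1]
  exact lintegral_sub_right_eq_self (μ := volume)
    (fun s => ∫⁻ φ in Set.Ioc (-Real.pi) Real.pi, ∫⁻ z, F ((s, φ), z)) l

/-- Without a rotation no periodicity is needed, which suits transport along rays. -/
lemma lintegral_logMeasure_shift {F : H1 → ℝ≥0∞} (hF : Measurable F)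
    {c : ℝ → ℝ} (hc : Measurable c) (l : ℝ) :
    ∫⁻ p, F ((p.1.1 - l, p.1.2), p.2 + c p.1.1) ∂logMeasure = ∫⁻ p, F p ∂logMeasure := by
  have hz : ∀ s φ c, ∫⁻ z, F ((s, φ), z + c) = ∫⁻ z, F ((s, φ), z) := fun s φ c =>
    lintegral_add_right_eq_self (fun z => F ((s, φ), z)) c
  have h0 : Measurable fun p : H1 => F ((p.1.1 - l, p.1.2), p.2 + c p.1.1) :=
    hF.comp (by fun_prop)
  rw [lintegral_logMeasure hF, lintegral_logMeasure h0]
  simp only [hz]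
  exact lintegral_sub_right_eq_self (μ := volume)
    (fun s => ∫⁻ φ in Set.Ioc (-Real.pi) Real.pi, ∫⁻ z, F ((s, φ), z)) l

/-- Averaging over a parameter an estimate uniform in this parameter. -/
lemma lintegral_intervalIntegral_le {α : Type*} [MeasurableSpace α] [TopologicalSpace α]
    [OpensMeasurableSpace (ℝ × α)] {μ : Measure α} [SFinite μ] {G : ℝ → α → ℝ}
    (hG : Continuous fun x : ℝ × α => G x.1 x.2) (hG0 : ∀ t p, 0 ≤ G t p) {τ : ℝ} (hτ : 0 ≤ τ)
    {K : ℝ≥0∞} (hK : ∀ t, ∫⁻ p, ENNReal.ofReal (G t p) ∂μ ≤ K) :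
    ∫⁻ p, ENNReal.ofReal (∫ t in (0 : ℝ)..τ, G t p) ∂μ ≤ ENNReal.ofReal τ * K := by
  have h1 : ∀ p, ENNReal.ofReal (∫ t in (0 : ℝ)..τ, G t p) =
      ∫⁻ t in Set.Ioc 0 τ, ENNReal.ofReal (G t p) := by
    intro p
    rw [intervalIntegral.integral_of_le hτ, ofReal_integral_eq_lintegral_ofReal]
    · exact ((hG.comp (by fun_prop : Continuous fun t => (t, p))).intervalIntegrable 0 τ).1
    · exact Filter.Eventually.of_forall fun t => hG0 t p
  simp only [h1]
  have hm : Measurable fun x : ℝ × α => ENNReal.ofReal (G x.1 x.2) :=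
    ENNReal.measurable_ofReal.comp hG.measurable
  rw [lintegral_lintegral_swap (f := fun p t => ENNReal.ofReal (G t p))
    (hm.comp measurable_swap).aemeasurable]
  calc ∫⁻ t in Set.Ioc 0 τ, ∫⁻ p, ENNReal.ofReal (G t p) ∂μ ≤ ∫⁻ _ in Set.Ioc 0 τ, K :=
        lintegral_mono fun t => hK t
    _ = ENNReal.ofReal τ * K := by simp [mul_comm]

/-- Integrates the four-term holonomy bound. Three measurability hypotheses suffice, because
additivity of the lower integral needs only one measurable summand. -/
lemma lintegral_le_of_le_four_mul {α : Type*} [MeasurableSpace α] {μ : Measure α} {E : Set α}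
    (hE : MeasurableSet E) {f : α → ℝ≥0∞} {I₁ I₂ I₃ I₄ : α → ℝ}
    (hm1 : Measurable fun p => ENNReal.ofReal (I₁ p))
    (hm2 : Measurable fun p => ENNReal.ofReal (I₂ p))
    (hm3 : Measurable fun p => ENNReal.ofReal (I₃ p))
    (n1 : ∀ p, 0 ≤ I₁ p) (n2 : ∀ p, 0 ≤ I₂ p) (n3 : ∀ p, 0 ≤ I₃ p) (n4 : ∀ p, 0 ≤ I₄ p)
    {c₁ c₂ c₃ c₄ : ℝ} {K : ℝ≥0∞}
    (b1 : ∫⁻ p, ENNReal.ofReal (I₁ p) ∂μ ≤ ENNReal.ofReal c₁ * K)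
    (b2 : ∫⁻ p, ENNReal.ofReal (I₂ p) ∂μ ≤ ENNReal.ofReal c₂ * K)
    (b3 : ∫⁻ p, ENNReal.ofReal (I₃ p) ∂μ ≤ ENNReal.ofReal c₃ * K)
    (b4 : ∫⁻ p, ENNReal.ofReal (I₄ p) ∂μ ≤ ENNReal.ofReal c₄ * K)
    (h1 : 0 ≤ c₁) (h2 : 0 ≤ c₂) (h3 : 0 ≤ c₃) (h4 : 0 ≤ c₄)
    (hf : ∀ p ∈ E, f p ≤ ENNReal.ofReal (4 * (I₁ p + I₂ p + I₃ p + I₄ p))) :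
    ∫⁻ p in E, f p ∂μ ≤ ENNReal.ofReal (4 * (c₁ + c₂ + c₃ + c₄)) * K := by
  have hm12 : Measurable fun p => ENNReal.ofReal (I₁ p) + ENNReal.ofReal (I₂ p) := hm1.add hm2
  have hm123 : Measurable fun p => ENNReal.ofReal (I₁ p) + ENNReal.ofReal (I₂ p)
    + ENNReal.ofReal (I₃ p) := hm12.add hm3
  calc _ ≤ ∫⁻ p in E, ENNReal.ofReal 4 *
        (ENNReal.ofReal (I₁ p) + ENNReal.ofReal (I₂ p) + ENNReal.ofReal (I₃ p)
          + ENNReal.ofReal (I₄ p)) ∂μ := by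
        refine setLIntegral_mono' hE fun p hp => ?_
        rw [← ENNReal.ofReal_add (n1 p) (n2 p),
          ← ENNReal.ofReal_add (add_nonneg (n1 p) (n2 p)) (n3 p),
          ← ENNReal.ofReal_add (add_nonneg (add_nonneg (n1 p) (n2 p)) (n3 p)) (n4 p),
          ← ENNReal.ofReal_mul (by norm_num)]
        exact hf p hp
    _ ≤ ∫⁻ p, ENNReal.ofReal 4 *
        (ENNReal.ofReal (I₁ p) + ENNReal.ofReal (I₂ p) + ENNReal.ofReal (I₃ p)
          + ENNReal.ofReal (I₄ p)) ∂μ := setLIntegral_le_lintegral _ _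
    _ = ENNReal.ofReal 4 * (∫⁻ p, ENNReal.ofReal (I₁ p) ∂μ
          + ∫⁻ p, ENNReal.ofReal (I₂ p) ∂μ + ∫⁻ p, ENNReal.ofReal (I₃ p) ∂μ
          + ∫⁻ p, ENNReal.ofReal (I₄ p) ∂μ) := by
        rw [lintegral_const_mul' _ _ ENNReal.ofReal_ne_top,
          lintegral_add_left hm123, lintegral_add_left hm12, lintegral_add_left hm1]
    _ ≤ ENNReal.ofReal 4 * (ENNReal.ofReal c₁ * K + ENNReal.ofReal c₂ * K
          + ENNReal.ofReal c₃ * K + ENNReal.ofReal c₄ * K) := by gcongr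
    _ = _ := by
        rw [← add_mul, ← add_mul, ← add_mul, ← ENNReal.ofReal_add h1 h2,
          ← ENNReal.ofReal_add (by positivity) h3, ← ENNReal.ofReal_add (by positivity) h4,
          ← mul_assoc, ← ENNReal.ofReal_mul (by norm_num)]

/-- The squared modulus of `u`, in logarithmic cylindrical coordinates. -/
def logDensity (u : H1 → ℂ) (p : H1) : ℝ := ‖u (cyl (expRadius p))‖ ^ 2

lemma continuous_logDensity {u : H1 → ℂ} (hu : Continuous u) :
    Continuous (logDensity u) :=
  ((hu.comp (contDiff_cyl.continuous.comp continuous_expRadius)).norm).pow 2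

namespace VectorPotential

/-- The energy of `u`, in logarithmic cylindrical coordinates. -/
def logEnergy (A : VectorPotential) (u : H1 → ℂ) : ℝ≥0∞ :=
  ∫⁻ p, ENNReal.ofReal (A.radialEnergy u p + A.angularEnergy u p) ∂logMeasure

variable {A : VectorPotential} {u : H1 → ℂ}

lemma radialEnergy_nonneg (p : H1) : 0 ≤ A.radialEnergy u p := by
  unfold radialEnergy; positivity

lemma angularEnergy_nonneg (p : H1) : 0 ≤ A.angularEnergy u p := by
  unfold angularEnergy; positivity

lemma lintegral_radialEnergy_le :
    ∫⁻ p, ENNReal.ofReal (A.radialEnergy u p) ∂logMeasure ≤ A.logEnergy u :=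
  lintegral_mono fun p => ENNReal.ofReal_le_ofReal
    (le_add_of_nonneg_right (angularEnergy_nonneg p))

lemma lintegral_angularEnergy_le :
    ∫⁻ p, ENNReal.ofReal (A.angularEnergy u p) ∂logMeasure ≤ A.logEnergy u :=
  lintegral_mono fun p => ENNReal.ofReal_le_ofReal
    (le_add_of_nonneg_left (radialEnergy_nonneg p))

/-- For each fixed `t`, moving the base point along its helix preserves the measure. One factor `τ`
comes from Cauchy–Schwarz and the other from integrating over `t`. -/
lemma lintegral_helix_le (hu : ContDiff ℝ ∞ u) (l : ℝ) {τ : ℝ} (hτ : 0 ≤ τ) :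
    ∫⁻ p : H1, ENNReal.ofReal (τ * ∫ t in (0 : ℝ)..τ, A.angularEnergy u
      ((p.1.1 - l, p.1.2 + t), p.2 + Real.exp (p.1.1 - l) ^ 2 / 2 * t)) ∂logMeasure ≤
      ENNReal.ofReal (τ ^ 2) * A.logEnergy u := by
  have hc := A.continuous_angularEnergy hu
  simp only [ENNReal.ofReal_mul hτ, sq τ]
  rw [lintegral_const_mul' _ _ ENNReal.ofReal_ne_top, mul_assoc]
  gcongr
  refine lintegral_intervalIntegral_le (G := fun t (p : H1) => A.angularEnergy u
      ((p.1.1 - l, p.1.2 + t), p.2 + Real.exp (p.1.1 - l) ^ 2 / 2 * t))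
      (by fun_prop) (fun t p => angularEnergy_nonneg _) hτ fun t => ?_
  refine le_trans (le_of_eq ?_) lintegral_angularEnergy_le
  exact lintegral_logMeasure_translate (F := fun p => ENNReal.ofReal (A.angularEnergy u p))
    (by fun_prop) (fun s φ z => by rw [angularEnergy_add_two_pi])
    (c := fun s => Real.exp (s - l) ^ 2 / 2 * t) (by fun_prop) l t

lemma lintegral_ray_le (hu : ContDiff ℝ ∞ u) {c : ℝ → ℝ} (hc : Continuous c) {τ : ℝ}
    (hτ : 0 ≤ τ) :
    ∫⁻ p : H1, ENNReal.ofReal (τ * ∫ t in (0 : ℝ)..τ, A.radialEnergy u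
      ((p.1.1 - t, p.1.2), p.2 + c p.1.1)) ∂logMeasure ≤
      ENNReal.ofReal (τ ^ 2) * A.logEnergy u := by
  have hR := A.continuous_radialEnergy hu
  simp only [ENNReal.ofReal_mul hτ, sq τ]
  rw [lintegral_const_mul' _ _ ENNReal.ofReal_ne_top, mul_assoc]
  gcongr
  refine lintegral_intervalIntegral_le (G := fun t (p : H1) => A.radialEnergy u
      ((p.1.1 - t, p.1.2), p.2 + c p.1.1))
      (by fun_prop) (fun t p => radialEnergy_nonneg _) hτ fun t => ?_
  refine le_trans (le_of_eq ?_) lintegral_radialEnergy_le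
  exact lintegral_logMeasure_shift (F := fun p => ENNReal.ofReal (A.radialEnergy u p))
    (by fun_prop) hc.measurable t

/-- The Hardy inequality away from the center. -/
lemma IsPotentialOf.lintegral_exterior_le {B : MagneticField}
    (hA : A.IsPotentialOf B) {r₀ : ℝ} (hr₀ : 0 < r₀) (hB : B.SupportedInCylinder r₀)
    (hu : ContDiff ℝ ∞ u) :
    ENNReal.ofReal (‖Complex.exp (2 * Real.pi * B.flux * Complex.I) - 1‖ ^ 2) *
        ∫⁻ p in {p : H1 | Real.log r₀ + Real.log 2 / 2 < p.1.1},
          ENNReal.ofReal (logDensity u p) ∂logMeasure ≤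
      ENNReal.ofReal (4 * ((2 * Real.pi) ^ 2 + (4 * Real.pi) ^ 2 + (Real.log 2 / 2) ^ 2
        + (Real.log 2 / 2) ^ 2)) * A.logEnergy u := by
  have hT := A.continuous_angularEnergy hu
  have hR := A.continuous_radialEnergy hu
  have n : ∀ {τ : ℝ} {g : ℝ → ℝ}, 0 ≤ τ → (∀ t, 0 ≤ g t) → 0 ≤ τ * ∫ t in (0 : ℝ)..τ, g t :=
    fun hτ hg => mul_nonneg hτ (intervalIntegral.integral_nonneg hτ fun t _ => hg t)
  have hmeas : ∀ {τ : ℝ} {G : H1 → ℝ → ℝ}, Continuous (fun x : H1 × ℝ => G x.1 x.2) →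
      Measurable fun p => ENNReal.ofReal (τ * ∫ t in (0 : ℝ)..τ, G p t) := fun {τ G} hG =>
    ENNReal.measurable_ofReal.comp (measurable_const.mul
      (intervalIntegral.continuous_parametric_intervalIntegral_of_continuous' hG 0 τ).measurable)
  have hL0 : 0 ≤ Real.log 2 / 2 := by positivity
  rw [← lintegral_const_mul' _ _ ENNReal.ofReal_ne_top]
  refine lintegral_le_of_le_four_mul (measurableSet_lt measurable_const (by fun_prop))
    (hmeas (by fun_prop)) (hmeas (by fun_prop)) (hmeas (by fun_prop))
    (fun p => n (by positivity) fun t => angularEnergy_nonneg _)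
    (fun p => n (by positivity) fun t => angularEnergy_nonneg _)
    (fun p => n (by positivity) fun t => radialEnergy_nonneg _)
    (fun p => n (by positivity) fun t => radialEnergy_nonneg _)
    (lintegral_helix_le hu 0 (by positivity)) (lintegral_helix_le hu (Real.log 2 / 2)
      (by positivity)) (lintegral_ray_le hu (c := fun _ => 0) continuous_const hL0)
    (lintegral_ray_le hu (c := fun s => Real.exp s ^ 2 * Real.pi) (by fun_prop) hL0)
    (sq_nonneg _) (sq_nonneg _) (sq_nonneg _) (sq_nonneg _) fun p hp => ?_
  rw [← ENNReal.ofReal_mul (by positivity)]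
  refine ENNReal.ofReal_le_ofReal ?_
  -- The threshold `log r₀ + log √2` keeps the inner helix, and so the whole loop, outside the
  -- support.
  have hs : r₀ < Real.exp (p.1.1 - Real.log 2 / 2) := by
    rw [← Real.log_lt_iff_lt_exp hr₀]
    have : Real.log r₀ + Real.log 2 / 2 < p.1.1 := hp
    linarith
  have := hA.holonomy_le hr₀ hB hu hs p.1.2 p.2
  simp only [sub_zero, add_zero]
  exact this

end VectorPotential

/-! ### The logarithmic Hardy inequality near the axis -/

lemma continuousOn_inv_shift (b : ℝ) : ContinuousOn (fun s : ℝ => (1 + b - s)⁻¹) (Set.Iic b) :=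
  ContinuousOn.inv₀ (by fun_prop) fun s (hs : s ≤ b) => by
    have : 0 < 1 + b - s := by linarith
    exact this.ne'

/-- A one-dimensional logarithmic Hardy inequality. -/
lemma integral_hardy_le {f f' ρ : ℝ → ℝ} (hf : ∀ s, HasDerivAt f (f' s) s)
    (hf' : Continuous f') (hρ : Continuous ρ) (hf0 : ∀ s, 0 ≤ f s) (hρ0 : ∀ s, 0 ≤ ρ s)
    (hb : ∀ s, f' s ^ 2 ≤ 4 * f s * ρ s) {a b : ℝ} (hab : a ≤ b) :
    ∫ s in a..b, f s * (1 + b - s)⁻¹ ^ 2 ≤ 2 * f b + 4 * ∫ s in a..b, ρ s := by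
  have hfc : Continuous f := continuous_iff_continuousAt.2 fun s => (hf s).continuousAt
  have hh : ContinuousOn (fun s : ℝ => (1 + b - s)⁻¹) (Set.uIcc a b) :=
    (continuousOn_inv_shift b).mono fun s hs => by
      rw [Set.uIcc_of_le hab] at hs
      exact hs.2
  have hd : ∀ s ∈ Set.uIcc a b, HasDerivAt (fun s : ℝ => (1 + b - s)⁻¹)
      ((1 + b - s)⁻¹ ^ 2) s := by
    intro s hs
    rw [Set.uIcc_of_le hab] at hs
    have h0 : 1 + b - s ≠ 0 := by
      have := hs.2
      have : 0 < 1 + b - s := by linarith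
      exact this.ne'
    have := ((hasDerivAt_id s).const_sub (1 + b)).inv h0
    convert! this using 1
    simp
  have i1 : IntervalIntegrable (fun s => f s * (1 + b - s)⁻¹ ^ 2) volume a b :=
    (hfc.continuousOn.mul (hh.pow 2)).intervalIntegrable
  have i2 : IntervalIntegrable (fun s => f' s * (1 + b - s)⁻¹) volume a b :=
    (hf'.continuousOn.mul hh).intervalIntegrable
  have i3 : IntervalIntegrable ρ volume a b := hρ.intervalIntegrable _ _
  -- With `h = (1 + b - s)⁻¹` one has `h' = h²` and `h(b) = 1`, so this is the integral of `(f h)'`.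
  have h1 : ∫ s in a..b, (f' s * (1 + b - s)⁻¹ + f s * (1 + b - s)⁻¹ ^ 2) =
      f b - f a * (1 + b - a)⁻¹ := by
    rw [intervalIntegral.integral_eq_sub_of_hasDerivAt
      (f := fun s => f s * (1 + b - s)⁻¹) (fun s hs => (hf s).mul (hd s hs)) (i2.add i1)]
    simp
  rw [intervalIntegral.integral_add i2 i1] at h1
  -- From `|f'| ≤ 2 √(f ρ)` and Young's inequality, `|f' h| ≤ f h² / 2 + 2ρ`; the first term is
  -- absorbed on the left.
  have h2 : ∫ s in a..b, -(f' s * (1 + b - s)⁻¹) ≤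
      ∫ s in a..b, (1 / 2 * (f s * (1 + b - s)⁻¹ ^ 2) + 2 * ρ s) := by
    refine intervalIntegral.integral_mono_on hab i2.neg
      ((i1.const_mul _).add (i3.const_mul _)) fun s _ => ?_
    have h3 := hb s
    have h4 := hf0 s
    have h5 := hρ0 s
    set h := (1 + b - s)⁻¹
    have h6 : (f' s * h) ^ 2 ≤ (1 / 2 * (f s * h ^ 2) + 2 * ρ s) ^ 2 := by
      have : (f' s * h) ^ 2 ≤ 4 * f s * ρ s * h ^ 2 := by
        rw [mul_pow]; gcongr
      nlinarith [sq_nonneg (1 / 2 * (f s * h ^ 2) - 2 * ρ s)]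
    exact (neg_le_abs _).trans (abs_le_of_sq_le_sq h6 (by positivity))
  rw [intervalIntegral.integral_neg, intervalIntegral.integral_add (i1.const_mul _)
    (i3.const_mul _), intervalIntegral.integral_const_mul, intervalIntegral.integral_const_mul]
    at h2
  have h7 : 0 ≤ f a * (1 + b - a)⁻¹ := mul_nonneg (hf0 a) (inv_nonneg.2 (by linarith))
  linarith

lemma lintegral_hardy_le {f f' ρ : ℝ → ℝ} (hf : ∀ s, HasDerivAt f (f' s) s)
    (hf' : Continuous f') (hρ : Continuous ρ) (hf0 : ∀ s, 0 ≤ f s) (hρ0 : ∀ s, 0 ≤ ρ s)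
    (hb : ∀ s, f' s ^ 2 ≤ 4 * f s * ρ s) (b : ℝ) :
    ∫⁻ s in Set.Iic b, ENNReal.ofReal (f s * (1 + b - s)⁻¹ ^ 2) ≤
      ENNReal.ofReal 2 * ENNReal.ofReal (f b)
        + ENNReal.ofReal 4 * ∫⁻ s, ENNReal.ofReal (ρ s) := by
  have hfc : Continuous f := continuous_iff_continuousAt.2 fun s => (hf s).continuousAt
  have hmeas : Measurable fun s => ENNReal.ofReal (f s * (1 + b - s)⁻¹ ^ 2) := by fun_prop
  have hcov : AECover (volume.restrict (Set.Iic b)) atTop fun n : ℕ => Set.Ioi (-(n : ℝ)) :=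
    aecover_Ioi (tendsto_neg_atTop_atBot.comp tendsto_natCast_atTop_atTop)
  refine le_of_tendsto' (hcov.lintegral_tendsto_of_nat hmeas.aemeasurable) fun n => ?_
  rw [Measure.restrict_restrict measurableSet_Ioi, Set.Ioi_inter_Iic]
  rcases lt_or_ge b (-(n : ℝ)) with h | h
  · rw [Set.Ioc_eq_empty (by linarith)]
    simp
  have hi : IntegrableOn (fun s => f s * (1 + b - s)⁻¹ ^ 2) (Set.Ioc (-(n : ℝ)) b) :=
    ((hfc.continuousOn.mul ((continuousOn_inv_shift b).pow 2)).mono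
      Set.Icc_subset_Iic_self).integrableOn_compact isCompact_Icc |>.mono_set
        Set.Ioc_subset_Icc_self
  rw [← ofReal_integral_eq_lintegral_ofReal hi
    (Filter.Eventually.of_forall fun s => mul_nonneg (hf0 s) (sq_nonneg _)),
    ← intervalIntegral.integral_of_le h]
  refine (ENNReal.ofReal_le_ofReal (integral_hardy_le hf hf' hρ hf0 hρ0 hb h)).trans ?_
  have h0 : 0 ≤ ∫ s in (-(n : ℝ))..b, ρ s :=
    intervalIntegral.integral_nonneg h fun s _ => hρ0 s
  rw [ENNReal.ofReal_add (mul_nonneg zero_le_two (hf0 b)) (by positivity),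
    ENNReal.ofReal_mul zero_le_two, ENNReal.ofReal_mul zero_le_four,
    intervalIntegral.integral_of_le h, ofReal_integral_eq_lintegral_ofReal
      (hρ.intervalIntegrable _ _).1 (Filter.Eventually.of_forall hρ0)]
  gcongr
  exact Measure.restrict_le_self

/-- The logarithmic Hardy inequality, with the boundary term averaged over `[b, b + 1]`. -/
lemma lintegral_hardy_average_le {f f' ρ : ℝ → ℝ} (hf : ∀ s, HasDerivAt f (f' s) s)
    (hf' : Continuous f') (hρ : Continuous ρ) (hf0 : ∀ s, 0 ≤ f s) (hρ0 : ∀ s, 0 ≤ ρ s)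
    (hb : ∀ s, f' s ^ 2 ≤ 4 * f s * ρ s) (b : ℝ) :
    ∫⁻ s in Set.Iic b, ENNReal.ofReal (f s * (2 + b - s)⁻¹ ^ 2) ≤
      ENNReal.ofReal 2 * (∫⁻ s in Set.Ioi b, ENNReal.ofReal (f s))
        + ENNReal.ofReal 4 * ∫⁻ s, ENNReal.ofReal (ρ s) := by
  have hfc : Continuous f := continuous_iff_continuousAt.2 fun s => (hf s).continuousAt
  -- For `t ≤ b + 1` one has `1 + t - s ≤ 2 + b - s`, so the weight with `2 + b` is below every
  -- weight based at `t`. Averaging over an interval of length one then replaces the point value `f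
  -- t` by an integral.
  have h1 : ∀ t ∈ Set.Ioc b (b + 1),
      ∫⁻ s in Set.Iic b, ENNReal.ofReal (f s * (2 + b - s)⁻¹ ^ 2) ≤
      ENNReal.ofReal 2 * ENNReal.ofReal (f t)
        + ENNReal.ofReal 4 * ∫⁻ s, ENNReal.ofReal (ρ s) := by
    intro t ht
    refine le_trans ?_ (lintegral_hardy_le hf hf' hρ hf0 hρ0 hb t)
    refine (setLIntegral_mono' measurableSet_Iic fun s (hs : s ≤ b) => ?_).trans
      (lintegral_mono_set (Set.Iic_subset_Iic.2 ht.1.le))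
    refine ENNReal.ofReal_le_ofReal ?_
    have h2 := ht.1
    have h3 := ht.2
    have h4 := hf0 s
    have h5 : 0 < 1 + t - s := by linarith
    have h6 : (2 + b - s)⁻¹ ≤ (1 + t - s)⁻¹ := inv_anti₀ h5 (by linarith)
    have h7 : 0 ≤ (2 + b - s)⁻¹ := inv_nonneg.2 (by linarith)
    gcongr
  calc _ = ∫⁻ _ in Set.Ioc b (b + 1),
        ∫⁻ s in Set.Iic b, ENNReal.ofReal (f s * (2 + b - s)⁻¹ ^ 2) := by simp
    _ ≤ ∫⁻ t in Set.Ioc b (b + 1), (ENNReal.ofReal 2 * ENNReal.ofReal (f t)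
        + ENNReal.ofReal 4 * ∫⁻ s, ENNReal.ofReal (ρ s)) :=
      setLIntegral_mono' measurableSet_Ioc h1
    _ = ENNReal.ofReal 2 * (∫⁻ s in Set.Ioc b (b + 1), ENNReal.ofReal (f s))
        + ENNReal.ofReal 4 * ∫⁻ s, ENNReal.ofReal (ρ s) := by
      rw [lintegral_add_right _ measurable_const,
        lintegral_const_mul' _ _ ENNReal.ofReal_ne_top]
      simp
    _ ≤ _ := by
      gcongr
      exact Set.Ioc_subset_Ioi_self

namespace VectorPotential

variable {A : VectorPotential} {u : H1 → ℂ}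

/-- The diamagnetic inequality in the radial direction. -/
lemma exists_hasDerivAt_logDensity (hu : ContDiff ℝ ∞ u) (φ z : ℝ) :
    ∃ f' : ℝ → ℝ, Continuous f' ∧
      (∀ s, HasDerivAt (fun s => logDensity u ((s, φ), z)) (f' s) s) ∧
      ∀ s, f' s ^ 2 ≤ 4 * logDensity u ((s, φ), z) * A.radialEnergy u ((s, φ), z) := by
  let γ : ℝ → H1 := fun s => expRadius ((s, φ), z)
  have hγ : ∀ s, HasDerivAt γ ((Real.exp s, 0), 0) s := fun s =>
    ((Real.hasDerivAt_exp s).prodMk (hasDerivAt_const s _)).prodMk (hasDerivAt_const s _)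
  have hγc : Continuous γ := continuous_iff_continuousAt.2 fun s => (hγ s).continuousAt
  have hg : ∀ s, HasDerivAt (fun s => u (cyl (γ s)))
      (fderiv ℝ u (cyl (γ s)) (fderiv ℝ cyl (γ s) ((Real.exp s, 0), 0))) s := fun s =>
    (hu.differentiable (by simp) _).hasFDerivAt.comp_hasDerivAt s
      ((contDiff_cyl.differentiable (by simp) _).hasFDerivAt.comp_hasDerivAt s (hγ s))
  refine ⟨_, ?_, fun s => (hg s).norm_sq, fun s => ?_⟩
  · have h1 := (hu.fderiv_right (m := ∞) (by simp)).continuous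
    have h2 := (contDiff_cyl.fderiv_right (m := ∞) (by simp)).continuous
    have h3 := hu.continuous
    have h4 := contDiff_cyl.continuous
    fun_prop
  · set g := u (cyl (γ s)) with hgdef
    set d := fderiv ℝ u (cyl (γ s)) (fderiv ℝ cyl (γ s) ((Real.exp s, 0), 0)) with hd
    have hcov : d + Complex.I * (A.cylForm (γ s) ((Real.exp s, 0), 0) : ℂ) * g =
        Real.exp s * A.covRadial u (γ s) := by
      rw [hd, hgdef, A.fderiv_add_cylForm _ _ (by simp)]
      simp
    -- The potential contributes `i a g` with `a` real, which is orthogonal to `g` for the real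
    -- inner product.
    have hin : inner ℝ g d = inner ℝ g (Real.exp s * A.covRadial u (γ s)) := by
      rw [← hcov, inner_add_right]
      simp [Complex.inner]
      ring
    have hcs := abs_real_inner_le_norm g (Real.exp s * A.covRadial u (γ s))
    have hsq : inner ℝ g d ^ 2 ≤ (‖g‖ * ‖(Real.exp s * A.covRadial u (γ s) : ℂ)‖) ^ 2 := by
      rw [hin, ← sq_abs]
      gcongr
    rw [norm_mul, Complex.norm_real, Real.norm_of_nonneg (Real.exp_pos s).le] at hsq
    have e1 : logDensity u ((s, φ), z) = ‖g‖ ^ 2 := rfl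
    have e2 : A.radialEnergy u ((s, φ), z) = Real.exp s ^ 2 * ‖A.covRadial u (γ s)‖ ^ 2 := rfl
    rw [e1, e2]
    nlinarith

/-- The logarithmic Hardy inequality near the center. -/
lemma lintegral_interior_le (hu : ContDiff ℝ ∞ u) (b : ℝ) :
    ∫⁻ p in {p : H1 | p.1.1 ≤ b},
        ENNReal.ofReal (logDensity u p * (2 + b - p.1.1)⁻¹ ^ 2) ∂logMeasure ≤
      ENNReal.ofReal 2 * (∫⁻ p in {p : H1 | b < p.1.1},
        ENNReal.ofReal (logDensity u p) ∂logMeasure) + ENNReal.ofReal 4 * A.logEnergy u := by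
  have hf := continuous_logDensity hu.continuous
  have hR := A.continuous_radialEnergy hu
  have hE : MeasurableSet {p : H1 | p.1.1 ≤ b} := measurableSet_le (by fun_prop) measurable_const
  have hE' : MeasurableSet {p : H1 | b < p.1.1} := measurableSet_lt measurable_const (by fun_prop)
  have hm1 : Measurable fun p : H1 =>
      ENNReal.ofReal (logDensity u p * (2 + b - p.1.1)⁻¹ ^ 2) := by fun_prop
  have hm2 : Measurable fun p : H1 => ENNReal.ofReal (logDensity u p) := by fun_prop
  have hm3 : Measurable fun p : H1 => ENNReal.ofReal (A.radialEnergy u p) := by fun_prop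
  set Φ : H1 → ℝ≥0∞ := fun p => ENNReal.ofReal 2 *
    {p : H1 | b < p.1.1}.indicator (fun p => ENNReal.ofReal (logDensity u p)) p
      + ENNReal.ofReal 4 * ENNReal.ofReal (A.radialEnergy u p) with hΦ
  have hmΦ : Measurable Φ :=
    (measurable_const.mul (hm2.indicator hE')).add (measurable_const.mul hm3)
  calc _ = ∫⁻ p, {p : H1 | p.1.1 ≤ b}.indicator (fun p =>
        ENNReal.ofReal (logDensity u p * (2 + b - p.1.1)⁻¹ ^ 2)) p ∂logMeasure :=
      (lintegral_indicator hE _).symm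
    _ ≤ ∫⁻ p, Φ p ∂logMeasure := by
      -- Integrating over `s` first allows the one-dimensional inequality on each ray.
      rw [lintegral_logMeasure_symm (hm1.indicator hE), lintegral_logMeasure_symm hmΦ]
      refine lintegral_mono fun z => lintegral_mono fun φ => ?_
      obtain ⟨f', hf', hder, hb⟩ := exists_hasDerivAt_logDensity (A := A) hu φ z
      have key := lintegral_hardy_average_le hder hf'
        (by fun_prop : Continuous fun s => A.radialEnergy u ((s, φ), z))
        (fun s => by unfold logDensity; positivity) (fun s => radialEnergy_nonneg _) hb b
      have e1 : ∫⁻ s, {p : H1 | p.1.1 ≤ b}.indicator (fun p =>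
          ENNReal.ofReal (logDensity u p * (2 + b - p.1.1)⁻¹ ^ 2)) ((s, φ), z) =
          ∫⁻ s in Set.Iic b, ENNReal.ofReal (logDensity u ((s, φ), z) * (2 + b - s)⁻¹ ^ 2) := by
        rw [← lintegral_indicator measurableSet_Iic]
        rfl
      have e2 : ∫⁻ s, {p : H1 | b < p.1.1}.indicator (fun p =>
          ENNReal.ofReal (logDensity u p)) ((s, φ), z) =
          ∫⁻ s in Set.Ioi b, ENNReal.ofReal (logDensity u ((s, φ), z)) := by
        rw [← lintegral_indicator measurableSet_Ioi]
        rfl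
      have hm4 : Measurable fun s => {p : H1 | b < p.1.1}.indicator (fun p =>
          ENNReal.ofReal (logDensity u p)) ((s, φ), z) :=
        (hm2.indicator hE').comp (by fun_prop : Measurable fun s : ℝ => (((s, φ), z) : H1))
      rw [e1]
      refine key.trans (le_of_eq ?_)
      rw [hΦ, lintegral_add_left (hm4.const_mul _), lintegral_const_mul _ hm4,
        lintegral_const_mul' _ _ ENNReal.ofReal_ne_top, e2]
    _ = ENNReal.ofReal 2 * (∫⁻ p in {p : H1 | b < p.1.1},
          ENNReal.ofReal (logDensity u p) ∂logMeasure)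
        + ENNReal.ofReal 4 * ∫⁻ p, ENNReal.ofReal (A.radialEnergy u p) ∂logMeasure := by
      rw [hΦ, lintegral_add_left ((hm2.indicator hE').const_mul _),
        lintegral_const_mul _ (hm2.indicator hE'),
        lintegral_const_mul' _ _ ENNReal.ofReal_ne_top, lintegral_indicator hE']
    _ ≤ _ := by
      gcongr
      exact lintegral_radialEnergy_le

end VectorPotential

/-! ### The Hardy inequality with a uniform constant -/

lemma logMinus_nonneg (s : ℝ) : 0 ≤ logMinus s := le_max_left _ _

/-- Changing the reference radius from `exp b` to `r₁` shifts the logarithm by `b - log r₁`, which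
costs a constant factor. -/
lemma inv_one_add_logMinus_sq_le {s b r₁ : ℝ} (hr₁ : 0 < r₁) (hs : s ≤ b) :
    (1 + logMinus (Real.exp s / r₁) ^ 2)⁻¹ ≤
      2 * (2 + |b - Real.log r₁|) ^ 2 * (2 + b - s)⁻¹ ^ 2 := by
  set m := logMinus (Real.exp s / r₁) with hm
  set k := 2 + |b - Real.log r₁| with hk
  have hm0 : 0 ≤ m := logMinus_nonneg _
  have hm1 : Real.log r₁ - s ≤ m := by
    rw [hm, logMinus, Real.log_div (Real.exp_pos s).ne' hr₁.ne', Real.log_exp]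
    exact (le_of_eq (by ring)).trans (le_max_right _ _)
  have hk2 : 2 ≤ k := by rw [hk]; linarith [abs_nonneg (b - Real.log r₁)]
  have hx : 2 + b - s ≤ k + m := by linarith [le_abs_self (b - Real.log r₁)]
  have hx0 : 0 < 2 + b - s := by linarith
  have h1 : (2 + b - s) ^ 2 ≤ 2 * k ^ 2 * (1 + m ^ 2) := by
    calc (2 + b - s) ^ 2 ≤ (k + m) ^ 2 := by gcongr
      _ ≤ 2 * k ^ 2 + 2 * m ^ 2 := by nlinarith [sq_nonneg (k - m)]
      _ ≤ _ := by nlinarith [sq_nonneg m, mul_nonneg (sq_nonneg m) (by nlinarith : 0 ≤ k ^ 2 - 1)]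
  rw [inv_pow, ← div_eq_mul_inv, le_div_iff₀ (by positivity), inv_mul_le_iff₀ (by positivity)]
  linarith

lemma measurable_logMinus : Measurable logMinus := by
  unfold logMinus
  fun_prop

/-- The Hardy inequality on smooth functions, in logarithmic cylindrical coordinates, with a
constant which does not depend on the vector potential. -/
lemma MagneticField.SupportedInCylinder.exists_lintegral_logDensity_le {B : MagneticField}
    {r₀ r₁ : ℝ} (hB : B.SupportedInCylinder r₀) (hr₀ : 0 < r₀) (hr₁ : 0 < r₁)
    (hflux : ∀ n : ℤ, B.flux ≠ (n : ℝ)) :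
    ∃ C : ℝ, 0 < C ∧ ∀ (A : VectorPotential) (u : H1 → ℂ), A.IsPotentialOf B →
      ContDiff ℝ ∞ u →
      ∫⁻ p, ENNReal.ofReal ((1 + logMinus (Real.exp p.1.1 / r₁) ^ 2)⁻¹ * logDensity u p)
        ∂logMeasure ≤ ENNReal.ofReal C * A.logEnergy u := by
  set δ := ‖Complex.exp (2 * Real.pi * B.flux * Complex.I) - 1‖ ^ 2 with hδ
  -- This is where non-integrality of the flux enters.
  have hδ0 : 0 < δ := by
    refine pow_pos (norm_pos_iff.2 (sub_ne_zero.2 fun h => ?_)) 2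
    obtain ⟨n, hn⟩ := Complex.exp_eq_one_iff.1 h
    refine hflux n ?_
    have h2 : (2 * Real.pi * Complex.I : ℂ) ≠ 0 := Complex.two_pi_I_ne_zero
    have h3 : (B.flux : ℂ) = n := mul_right_cancel₀ h2 (by rw [← hn]; ring)
    exact_mod_cast h3
  set K := 4 * ((2 * Real.pi) ^ 2 + (4 * Real.pi) ^ 2 + (Real.log 2 / 2) ^ 2
        + (Real.log 2 / 2) ^ 2) with hK
  have hK0 : 0 ≤ K := by positivity
  set b := Real.log r₀ + Real.log 2 / 2 with hb
  set k := 2 * (2 + |b - Real.log r₁|) ^ 2 with hk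
  have hk0 : 0 < k := by positivity
  -- The exterior costs `K / δ`. The interior costs twice that for the boundary term plus `4` for
  -- the radial energy, times `k` for the comparison of weights.
  refine ⟨k * (2 * (K / δ) + 4) + K / δ, by positivity, fun A u hA hu => ?_⟩
  have hf := continuous_logDensity hu.continuous
  have hf0 : ∀ p, 0 ≤ logDensity u p := fun p => by unfold logDensity; positivity
  have hE : MeasurableSet {p : H1 | p.1.1 ≤ b} := measurableSet_le (by fun_prop) measurable_const
  have hcompl : {p : H1 | p.1.1 ≤ b}ᶜ = {p : H1 | b < p.1.1} := by ext; simp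
  have hE' : MeasurableSet {p : H1 | b < p.1.1} := hcompl ▸ hE.compl
  have hext : ∫⁻ p in {p : H1 | b < p.1.1}, ENNReal.ofReal (logDensity u p) ∂logMeasure ≤
      ENNReal.ofReal (K / δ) * A.logEnergy u := by
    have h1 := hA.lintegral_exterior_le hr₀ hB hu
    rw [ENNReal.ofReal_div_of_pos hδ0, ← ENNReal.mul_div_right_comm,
      ENNReal.le_div_iff_mul_le (Or.inl (by simpa using hδ0)) (Or.inl ENNReal.ofReal_ne_top),
      mul_comm]
    exact h1
  have hint := VectorPotential.lintegral_interior_le (A := A) hu b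
  have hw1 : ∀ x : ℝ, (1 + logMinus x ^ 2)⁻¹ ≤ 1 := fun x =>
    inv_le_one_of_one_le₀ (by nlinarith [sq_nonneg (logMinus x)])
  rw [← lintegral_add_compl _ hE, hcompl]
  calc _ ≤ ENNReal.ofReal k * (∫⁻ p in {p : H1 | p.1.1 ≤ b},
        ENNReal.ofReal (logDensity u p * (2 + b - p.1.1)⁻¹ ^ 2) ∂logMeasure)
        + ∫⁻ p in {p : H1 | b < p.1.1}, ENNReal.ofReal (logDensity u p) ∂logMeasure := by
        rw [← lintegral_const_mul' _ _ ENNReal.ofReal_ne_top]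
        refine add_le_add (setLIntegral_mono' hE fun p hp => ?_)
          (setLIntegral_mono' hE' fun p hp => ?_)
        · rw [← ENNReal.ofReal_mul hk0.le]
          refine ENNReal.ofReal_le_ofReal ?_
          calc _ ≤ (k * (2 + b - p.1.1)⁻¹ ^ 2) * logDensity u p := by
                gcongr
                · exact hf0 p
                · exact inv_one_add_logMinus_sq_le hr₁ hp
            _ = _ := by ring
        · exact ENNReal.ofReal_le_ofReal (mul_le_of_le_one_left (hf0 p) (hw1 _))
    _ ≤ ENNReal.ofReal k * (ENNReal.ofReal 2 * (ENNReal.ofReal (K / δ) * A.logEnergy u)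
          + ENNReal.ofReal 4 * A.logEnergy u) + ENNReal.ofReal (K / δ) * A.logEnergy u := by
        gcongr
        exact hint.trans (by gcongr)
    _ = _ := by
        rw [ENNReal.ofReal_add (by positivity) (by positivity), ENNReal.ofReal_mul hk0.le,
          ENNReal.ofReal_add (by positivity) (by positivity), ENNReal.ofReal_mul (p := 2) (q := K / δ) zero_le_two]
        ring

/-! ### Return to Lebesgue measure and to the closed form -/

lemma lintegral_Ioi_zero_eq_exp (g : ℝ → ℝ≥0∞) :
    ∫⁻ r in Set.Ioi (0 : ℝ), g r = ∫⁻ s, ENNReal.ofReal (Real.exp s) * g (Real.exp s) := by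
  have h := lintegral_image_eq_lintegral_abs_deriv_mul MeasurableSet.univ
    (fun x _ => (Real.hasDerivAt_exp x).hasDerivWithinAt) Real.exp_injective.injOn g
  simpa [Real.range_exp, abs_of_pos (Real.exp_pos _)] using h

/-- Integration in logarithmic cylindrical coordinates. -/
lemma lintegral_eq_lintegral_logMeasure {G : H1 → ℝ≥0∞} (hG : Measurable G) :
    ∫⁻ q, G q = ∫⁻ p, ENNReal.ofReal (Real.exp p.1.1 ^ 2) * G (cyl (expRadius p))
      ∂logMeasure := by
  have hm : Measurable fun p : H1 =>
      ENNReal.ofReal (Real.exp p.1.1 ^ 2) * G (cyl (expRadius p)) :=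
    (by fun_prop : Measurable fun p : H1 => ENNReal.ofReal (Real.exp p.1.1 ^ 2)).mul
      (hG.comp (contDiff_cyl.continuous.comp continuous_expRadius).measurable)
  rw [lintegral_logMeasure_symm hm, Measure.volume_eq_prod, lintegral_prod_symm _ hG.aemeasurable]
  refine lintegral_congr fun z => ?_
  rw [← lintegral_comp_polarCoord_symm]
  have hm2 : Measurable fun p : ℝ × ℝ =>
      ENNReal.ofReal p.1 • G (polarCoord.symm p, z) :=
    (by fun_prop : Measurable fun p : ℝ × ℝ => ENNReal.ofReal p.1).mul
      (hG.comp ((continuous_polarCoord_symm.measurable).prodMk measurable_const))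
  have ht : polarCoord.target = Set.Ioi (0 : ℝ) ×ˢ Set.Ioo (-Real.pi) Real.pi := rfl
  rw [ht, Measure.volume_eq_prod, ← Measure.prod_restrict,
    lintegral_prod_symm _ hm2.aemeasurable, restrict_Ioo_eq_restrict_Ioc]
  refine lintegral_congr fun φ => ?_
  rw [lintegral_Ioi_zero_eq_exp]
  refine lintegral_congr fun s => ?_
  rw [smul_eq_mul, ← mul_assoc, ← ENNReal.ofReal_mul (Real.exp_pos s).le, ← sq]
  rfl

namespace VectorPotential

variable {A : VectorPotential} {u : H1 → ℂ}

lemma logEnergy_eq (hu : ContDiff ℝ ∞ u) : A.logEnergy u =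
    ∫⁻ q, ENNReal.ofReal (‖A.covX u q‖ ^ 2 + ‖A.covY u q‖ ^ 2) := by
  have h1 := A.continuous_covX hu
  have h2 := A.continuous_covY hu
  rw [lintegral_eq_lintegral_logMeasure (by fun_prop), logEnergy]
  refine lintegral_congr fun p => ?_
  rw [← ENNReal.ofReal_mul (sq_nonneg _), ← norm_covRadial_sq_add, radialEnergy, angularEnergy,
    mul_add]

/-- Compact support makes the energy density integrable, so the Bochner integral is a genuine value
and not the default `0`. -/
lemma logEnergy_eq_magneticForm (hu : IsTestFunction u) :
    A.logEnergy u = ENNReal.ofReal (magneticForm A u) := by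
  have h1 := A.continuous_covX hu.1
  have h2 := A.continuous_covY hu.1
  have hz : ∀ q ∉ tsupport u, fderiv ℝ u q = 0 ∧ u q = 0 := fun q hq =>
    ⟨Function.notMem_support.1 fun h => hq (support_fderiv_subset ℝ h),
      image_eq_zero_of_notMem_tsupport hq⟩
  have hs : HasCompactSupport fun q => ‖A.covX u q‖ ^ 2 + ‖A.covY u q‖ ^ 2 :=
    HasCompactSupport.intro hu.2 fun q hq => by
      simp [covX, covY, X, Y, (hz q hq).1, (hz q hq).2]
  have hi : Integrable (fun q => ‖A.covX u q‖ ^ 2 + ‖A.covY u q‖ ^ 2) (volume : Measure H1) :=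
    (by fun_prop : Continuous fun q => ‖A.covX u q‖ ^ 2 + ‖A.covY u q‖ ^ 2)
      |>.integrable_of_hasCompactSupport hs
  rw [logEnergy_eq hu.1, ← ofReal_integral_eq_lintegral_ofReal hi
    (Filter.Eventually.of_forall fun q => by positivity)]
  rfl

end VectorPotential

lemma continuous_radius : Continuous radius := by
  unfold radius
  fun_prop

/-- A form lower bound for a nonnegative weight only has to be checked on test functions. -/
lemma FormLowerBound.of_testFunction {A : VectorPotential} {w : H1 → ℝ} (hw : Measurable w)
    (hw0 : ∀ q, 0 ≤ w q)
    (h : ∀ v, IsTestFunction v →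
      ∫⁻ q, ENNReal.ofReal (w q * ‖v q‖ ^ 2) ≤ ENNReal.ofReal (magneticForm A v)) :
    FormLowerBound A w := by
  rintro u s ⟨v, hv, hlim, -, hs⟩
  have hum : AEStronglyMeasurable (u : H1 → ℂ) volume := Lp.aestronglyMeasurable u
  obtain ⟨ns, hns, hae⟩ := (tendstoInMeasure_of_tendsto_eLpNorm (p := 2) two_ne_zero
    (fun n => (hv n).1.continuous.aestronglyMeasurable) hum hlim).exists_seq_tendsto_ae
  have hs0 : 0 ≤ s := ge_of_tendsto' hs fun n => integral_nonneg fun q => by positivity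
  -- Convergence in `L²` gives an almost everywhere convergent subsequence, to which Fatou's lemma
  -- applies. Finiteness of the right side then gives integrability of the weighted density.
  have hfatou : ∫⁻ q, ENNReal.ofReal (w q * ‖u q‖ ^ 2) ≤ ENNReal.ofReal s := by
    calc ∫⁻ q, ENNReal.ofReal (w q * ‖u q‖ ^ 2)
        = ∫⁻ q, liminf (fun n => ENNReal.ofReal (w q * ‖v (ns n) q‖ ^ 2)) atTop := by
          refine lintegral_congr_ae (hae.mono fun q hq => ?_)
          exact (((ENNReal.continuous_ofReal.tendsto _).comp
            ((hq.norm.pow 2).const_mul (w q))).liminf_eq).symm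
      _ ≤ liminf (fun n => ∫⁻ q, ENNReal.ofReal (w q * ‖v (ns n) q‖ ^ 2)) atTop := by
          refine lintegral_liminf_le fun n => ?_
          have := (hv (ns n)).1.continuous.measurable
          fun_prop
      _ ≤ liminf (fun n => ENNReal.ofReal (magneticForm A (v (ns n)))) atTop :=
          liminf_le_liminf (Filter.Eventually.of_forall fun n => h _ (hv _))
      _ = ENNReal.ofReal s := ((ENNReal.continuous_ofReal.tendsto _).comp
            (hs.comp hns.tendsto_atTop)).liminf_eq
  have hm : AEStronglyMeasurable (fun q => w q * ‖u q‖ ^ 2) volume :=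
    hw.aestronglyMeasurable.mul (hum.norm.pow 2)
  have hnn : 0 ≤ᵐ[volume] fun q => w q * ‖u q‖ ^ 2 :=
    Filter.Eventually.of_forall fun q => mul_nonneg (hw0 q) (sq_nonneg _)
  refine ⟨⟨hm, (hasFiniteIntegral_iff_ofReal hnn).2 (hfatou.trans_lt ENNReal.ofReal_lt_top)⟩, ?_⟩
  rw [integral_eq_lintegral_of_nonneg_ae hnn hm]
  exact ENNReal.toReal_le_of_le_ofReal hs0 hfatou

end Heisenberg

end

theorem theorem6 (B : Heisenberg.MagneticField) (r₀ r₁ : ℝ) (hr₀ : 0 < r₀) (hr₁ : r₀ < r₁)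
    (hB : B.SupportedInCylinder r₀) (hflux : ∀ n : ℤ, B.flux ≠ (n : ℝ)) :
    ∃ c : ℝ, 0 < c ∧ ∀ A : Heisenberg.VectorPotential, A.IsPotentialOf B →
      Heisenberg.FormLowerBound A (fun q =>
        c / (Heisenberg.radius q ^ 2 *
          (1 + Heisenberg.logMinus (Heisenberg.radius q / r₁) ^ 2))) := by
  open Heisenberg in
  obtain ⟨C, hC, hmain⟩ := hB.exists_lintegral_logDensity_le hr₀ (hr₀.trans hr₁) hflux
  refine ⟨C⁻¹, inv_pos.2 hC, fun A hA => ?_⟩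
  have hr := continuous_radius.measurable
  have hl := measurable_logMinus
  -- On the axis the weight takes the value `0` of division by zero; the axis is a null set.
  have hw : Measurable fun q : H1 =>
      C⁻¹ / (radius q ^ 2 * (1 + logMinus (radius q / r₁) ^ 2)) := by fun_prop
  refine FormLowerBound.of_testFunction hw (fun q => by positivity) fun v hv => ?_
  have hvm := hv.1.continuous.measurable
  rw [← VectorPotential.logEnergy_eq_magneticForm hv,
    lintegral_eq_lintegral_logMeasure (by fun_prop)]
  calc _ = ∫⁻ p, ENNReal.ofReal C⁻¹ * ENNReal.ofReal
        ((1 + logMinus (Real.exp p.1.1 / r₁) ^ 2)⁻¹ * logDensity v p) ∂logMeasure := by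
        refine lintegral_congr fun p => ?_
        have hp : radius (cyl (expRadius p)) = Real.exp p.1.1 := radius_cyl (Real.exp_pos _).le
        rw [← ENNReal.ofReal_mul (sq_nonneg _), ← ENNReal.ofReal_mul (inv_pos.2 hC).le, hp,
          logDensity]
        congr 1
        have h1 := (Real.exp_pos p.1.1).ne'
        field_simp
    _ ≤ ENNReal.ofReal C⁻¹ * (ENNReal.ofReal C * A.logEnergy v) := by
        rw [lintegral_const_mul' _ _ ENNReal.ofReal_ne_top]
        gcongr
        exact hmain A v hA hv.1
    _ = A.logEnergy v := by
        rw [← mul_assoc, ← ENNReal.ofReal_mul (inv_pos.2 hC).le, inv_mul_cancel₀ hC.ne',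
          ENNReal.ofReal_one, one_mul]
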